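/- Let $M$ be a smooth $n$-manifold (without boundary) whose tangent bundle is the internal direct sum $TM=V\oplus H$ of two smooth distributions (subbundles) $V$ and $H$, where $H$ has rank $p$, and let $x\in M$. Assume that $H$ is twisted at $x$, i.e. that there are smooth local sections $X,Y$ of $H$ near $x$ whose Lie bracket satisfies $[X,Y](x)\notin H_x$. Let $g_V$ and $g_H$ be smooth Riemannian metrics on the vector bundles $V$ and $H$, respectively. Let $U\subseteq M$ be an open neighbourhood of $x$, and let $(f_k)_{k\in\mathbb N}$ be a sequence of smooth functions $f_k\colon M\to\mathbb R_{>0}$ such that $f_k\ge k$ on $U$ for every $k$. For $k\in\mathbb N$ let $g_k=(-f_k^2\,g_V)\oplus g_H$ denote the pseudo-Riemannian metric on $M$ which restricts to $-f_k^2\,g_V$ on $V$ and to $g_H$ on $H$, and which makes $V$ and $H$ orthogonal to each other; a tangent vector $v$ is called $g_k$-timelike if $g_k(v,v)<0$. Then there exists $k_U\in\mathbb N$ such that for all $k\ge k_U$, the open set $U$ does not admit a smooth $p$-dimensional foliation none of whose tangent vectors is $g_k$-timelike. -/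

import Mathlib

open Set Topology
open scoped Manifold ContDiff

/-- A smooth `p`-plane distribution on the `n`-manifold `M`, i.e. a rank-`p` sub vector bundle of
the tangent bundle: a family of subspaces of the tangent spaces which is spanned, locally around
each point, by `p` smooth pointwise linearly independent vector fields. -/
structure PlaneDistribution (n p : ℕ) (M : Type*) [TopologicalSpace M]
    [ChartedSpace (EuclideanSpace ℝ (Fin n)) M] [IsManifold (𝓡 n) ∞ M] where
  fiber : ∀ y : M, Submodule ℝ (TangentSpace (𝓡 n) y)
  exists_frame : ∀ y : M, ∃ W : Set M, IsOpen W ∧ y ∈ W ∧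
    ∃ s : Fin p → ∀ z : M, TangentSpace (𝓡 n) z,
      (∀ i, ContMDiffOn (𝓡 n) (𝓡 n).tangent ∞
        (fun z => (⟨z, s i z⟩ : TangentBundle (𝓡 n) M)) W) ∧
      ∀ z ∈ W, LinearIndependent ℝ (fun i => s i z) ∧
        Submodule.span ℝ (range fun i => s i z) = fiber z

namespace PlaneDistribution

variable {n p q : ℕ} {M : Type*} [TopologicalSpace M]
  [ChartedSpace (EuclideanSpace ℝ (Fin n)) M] [IsManifold (𝓡 n) ∞ M]

/-- `X` is, on some open neighbourhood of `x`, a smooth section in the distribution `H`.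
(The values of `X` away from `x` are irrelevant.) -/
def IsLocalSection (H : PlaneDistribution n p M) (x : M)
    (X : ∀ y : M, TangentSpace (𝓡 n) y) : Prop :=
  ∃ W : Set M, IsOpen W ∧ x ∈ W ∧
    ContMDiffOn (𝓡 n) (𝓡 n).tangent ∞
      (fun y => (⟨y, X y⟩ : TangentBundle (𝓡 n) M)) W ∧
    ∀ y ∈ W, X y ∈ H.fiber y

/-- `H` is twisted at `x`: the twistedness `Tw_H(v, w) = π([X, Y](x))`, where `X`, `Y` are any
local sections in `H` with `X x = v`, `Y x = w` and `π : T_x M → T_x M / H_x` is the projection,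
is nonzero for some `v`, `w` in `H_x`. -/
def TwistedAt (H : PlaneDistribution n p M) (x : M) : Prop :=
  ∃ X Y : ∀ y : M, TangentSpace (𝓡 n) y, H.IsLocalSection x X ∧ H.IsLocalSection x Y ∧
    (H.fiber x).mkQ (VectorField.mlieBracket (𝓡 n) X Y x) ≠ 0

/-- The tangent bundle is the internal direct sum of `V` and `H`. -/
def Complementary (V : PlaneDistribution n q M) (H : PlaneDistribution n p M) : Prop :=
  ∀ y : M, IsCompl (V.fiber y) (H.fiber y)

/-- A smooth Riemannian metric on the vector bundle `D`. Smoothness: the scalar product of any two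
smooth sections over an open set is smooth there. -/
structure RiemannianMetricOn (D : PlaneDistribution n p M) where
  form : ∀ y : M, LinearMap.BilinForm ℝ (D.fiber y)
  symm : ∀ (y : M) (v w : D.fiber y), form y v w = form y w v
  pos : ∀ (y : M) (v : D.fiber y), v ≠ 0 → 0 < form y v v
  smooth : ∀ (W : Set M) (X Y : ∀ y : M, D.fiber y), IsOpen W →
    ContMDiffOn (𝓡 n) (𝓡 n).tangent ∞
      (fun y => (⟨y, (X y : TangentSpace (𝓡 n) y)⟩ : TangentBundle (𝓡 n) M)) W →
    ContMDiffOn (𝓡 n) (𝓡 n).tangent ∞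
      (fun y => (⟨y, (Y y : TangentSpace (𝓡 n) y)⟩ : TangentBundle (𝓡 n) M)) W →
    ContMDiffOn (𝓡 n) 𝓘(ℝ, ℝ) ∞ (fun y => form y (X y) (Y y)) W

/-- The field `a ⊕ b` of bilinear forms on the tangent spaces which restricts to `a` on `V`, to `b`
on `H`, and which makes `V` and `H` orthogonal to each other. -/
noncomputable def sumForm {V : PlaneDistribution n q M} {H : PlaneDistribution n p M}
    (hVH : V.Complementary H) (a : ∀ y : M, LinearMap.BilinForm ℝ (V.fiber y))
    (b : ∀ y : M, LinearMap.BilinForm ℝ (H.fiber y)) (y : M) :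
    LinearMap.BilinForm ℝ (TangentSpace (𝓡 n) y) :=
  (a y).compl₁₂ ((V.fiber y).projectionOnto (H.fiber y) (hVH y))
      ((V.fiber y).projectionOnto (H.fiber y) (hVH y)) +
    (b y).compl₁₂ ((H.fiber y).projectionOnto (V.fiber y) (hVH y).symm)
      ((H.fiber y).projectionOnto (V.fiber y) (hVH y).symm)

end PlaneDistribution

/-- A tangent vector `v` is timelike with respect to the form `g` iff `g(v, v) < 0`. -/
def IsTimelike {T : Type*} [AddCommGroup T] [Module ℝ T] (g : LinearMap.BilinForm ℝ T) (v : T) :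
    Prop :=
  g v v < 0

/-- A smooth `p`-dimensional foliation on the subset `U` (in practice open) of the `n`-manifold `M`,
given by a foliated atlas: smooth charts with values in `ℝ^p × ℝ^(n-p)` which cover `U` and such
that every change of charts has locally the form `(a, b) ↦ (h₁(a, b), h₂(b))`.
The plaques are the slices on which the `ℝ^(n-p)`-component of a chart is constant. -/
structure Foliation (n p : ℕ) {M : Type*} [TopologicalSpace M]
    [ChartedSpace (EuclideanSpace ℝ (Fin n)) M] [IsManifold (𝓡 n) ∞ M] (U : Set M) where
  charts : Set (OpenPartialHomeomorph M
    (EuclideanSpace ℝ (Fin p) × EuclideanSpace ℝ (Fin (n - p))))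
  source_subset : ∀ φ ∈ charts, φ.source ⊆ U
  cover : ∀ y ∈ U, ∃ φ ∈ charts, y ∈ φ.source
  smooth : ∀ φ ∈ charts, ContMDiffOn (𝓡 n)
    𝓘(ℝ, EuclideanSpace ℝ (Fin p) × EuclideanSpace ℝ (Fin (n - p))) ∞ φ φ.source
  smooth_symm : ∀ φ ∈ charts, ContMDiffOn
    𝓘(ℝ, EuclideanSpace ℝ (Fin p) × EuclideanSpace ℝ (Fin (n - p))) (𝓡 n) ∞ φ.symm φ.target
  compatible : ∀ φ ∈ charts, ∀ ψ ∈ charts, ∀ y ∈ φ.source ∩ ψ.source,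
    ∃ W ∈ 𝓝 y, W ⊆ φ.source ∩ ψ.source ∧
      ∀ z₁ ∈ W, ∀ z₂ ∈ W, (φ z₁).2 = (φ z₂).2 → (ψ z₁).2 = (ψ z₂).2

/-- `v` is a tangent vector of the foliation `F` at `y`, i.e. tangent to the leaf through `y`: in a
foliated chart around `y`, the `ℝ^(n-p)`-component of `v` vanishes. (By compatibility of the charts
it does not matter which one is used.) -/
def Foliation.IsTangent {n p : ℕ} {M : Type*} [TopologicalSpace M]
    [ChartedSpace (EuclideanSpace ℝ (Fin n)) M] [IsManifold (𝓡 n) ∞ M] {U : Set M}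
    (F : Foliation n p U) (y : M) (v : TangentSpace (𝓡 n) y) : Prop :=
  ∃ φ ∈ F.charts, y ∈ φ.source ∧
    Prod.snd (α := EuclideanSpace ℝ (Fin p)) (β := EuclideanSpace ℝ (Fin (n - p)))
      (mfderiv (𝓡 n) 𝓘(ℝ, EuclideanSpace ℝ (Fin p) × EuclideanSpace ℝ (Fin (n - p))) φ y v) = 0

/-! If no vector tangent to a foliation is `g_k`-timelike, its `V`-component is at most a constant
times `1/k` times its `H`-component, uniformly near `x`. For large `k` the tangent spaces of the
foliation are thus uniformly close to `H`. The theorem is a `C⁰`-rigidity statement: a distribution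
that is not involutive at `x` is not a `C⁰`-limit of integrable ones, although brackets involve
derivatives.

In a chart, let `V₀` be the constant subspace given by `V` at `x`. Near `x` it is transverse to `H`
and to every integrable `D` close to `H`. Project the constant vectors `X x`, `Y x` along `V₀`, once
to `H` and once to `D`. The two fields in `D` have bracket in `D` by integrability and in `V₀`
because they differ from constants by elements of `V₀`; so they commute. The bracket at `x` of the
two fields in `H` is the `V₀`-component of `[X, Y](x)`, which is nonzero by twistedness
(`exists_norm_sub_gt_of_integrable`).

It remains to see that non-commuting fields are not `C⁰`-close to commuting ones
(`exists_lieBracket_ne_zero_of_norm_sub_le`). Commuting `X'`, `Y'` span a square `u` of side `r`.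
Its second difference is approximately both `r²` times the derivative of `X` along `Y` and `r²`
times that of `Y` along `X`, with errors using only the sizes of `X' - X` and `Y' - Y`. Hence the
bracket of `X` and `Y` would be too small. -/

section Flat

/-! ### Integral curves and squares spanned by commuting vector fields -/

open Metric VectorField

variable {E : Type*} [NormedAddCommGroup E] [NormedSpace ℝ E]

/-- An integral curve of a Lipschitz vector field exists as long as its speed bound does not allow
it to leave the ball. -/
lemma exists_integralCurve_mem_closedBall [CompleteSpace E] {X : E → E} {x p : E} {R ρ B r : ℝ}
    {K : NNReal} (hX : LipschitzOnWith K X (closedBall x R))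
    (hB : ∀ y ∈ closedBall x R, ‖X y‖ ≤ B) (hr : 0 ≤ r) (hρ : 0 ≤ ρ) (hR : 0 ≤ R) (hB0 : 0 ≤ B)
    (hBr : B * r ≤ R - ρ) (hp : p ∈ closedBall x ρ) :
    ∃ α : ℝ → E, α 0 = p ∧ ∀ t ∈ Icc 0 r, α t ∈ closedBall x R ∧
      HasDerivWithinAt α (X (α t)) (Icc 0 r) t := by
  lift R to NNReal using hR
  lift ρ to NNReal using hρ
  lift B to NNReal using hB0
  have hP : IsPicardLindelof (fun _ => X) (⟨0, left_mem_Icc.2 hr⟩ : Icc (0 : ℝ) r) x R ρ B K :=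
    .of_time_independent hB hX (by simpa [hr] using hBr)
  -- The Picard fixed point itself is kept, since its function space records that the curve stays in
  -- the ball.
  obtain ⟨α, hα⟩ := ODE.FunSpace.exists_isFixedPt_next hP hp
  refine ⟨α.compProj, ?_, fun t ht => ⟨α.compProj_mem_closedBall hP.mul_max_le, ?_⟩⟩
  · have : α.compProj ((⟨0, left_mem_Icc.2 hr⟩ : Icc (0 : ℝ) r) : ℝ) = p := by
      rw [ODE.FunSpace.compProj_val, ← hα, ODE.FunSpace.next_apply₀]
    exact this
  · apply ODE.hasDerivWithinAt_picard_Icc (left_mem_Icc.2 hr) hP.continuousOn_uncurry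
      α.continuous_compProj.continuousOn (fun _ ht' ↦ α.compProj_mem_closedBall hP.mul_max_le)
      p ht |>.congr_of_mem _ ht
    intro t' ht'
    nth_rw 1 [← hα]
    rw [ODE.FunSpace.compProj_of_mem ht', ODE.FunSpace.next_apply]

/-- A `C^1` function on an open neighbourhood of a closed ball is Lipschitz on the ball. -/
lemma exists_lipschitzOnWith_closedBall [FiniteDimensional ℝ E] {F : Type*} [NormedAddCommGroup F]
    [NormedSpace ℝ F] {X : E → F} {x : E} {R : ℝ} {O : Set E} (hO : IsOpen O)
    (hRO : closedBall x R ⊆ O) (hX : ContDiffOn ℝ 1 X O) :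
    ∃ K : NNReal, LipschitzOnWith K X (closedBall x R) := by
  have : ProperSpace E := FiniteDimensional.proper ℝ E
  have hc : ContinuousOn (fderiv ℝ X) (closedBall x R) :=
    (hX.continuousOn_fderiv_of_isOpen hO le_rfl).mono hRO
  obtain ⟨C, hC⟩ := (isCompact_closedBall x R).exists_bound_of_continuousOn hc
  refine ⟨C.toNNReal, (convex_closedBall x R).lipschitzOnWith_of_nnnorm_fderiv_le (𝕜 := ℝ)
    (fun y hy => (hX.differentiableOn one_ne_zero).differentiableAt (hO.mem_nhds (hRO hy)))
    fun y hy => ?_⟩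
  rw [← NNReal.coe_le_coe, coe_nnnorm]
  exact (hC y hy).trans (Real.le_coe_toNNReal C)

/-- Nearby integral curves of `Y` whose initial points move along `X` move along `X` for all times
if `[X, Y] = 0`. -/
lemma hasDerivWithinAt_integralCurves_of_lieBracket_eq_zero {X Y : E → E} {x : E} {R r : ℝ}
    {K C : NNReal} (hr : 0 ≤ r)
    (hXd : ∀ y ∈ closedBall x R, DifferentiableAt ℝ X y)
    (hYd : ∀ y ∈ closedBall x R, DifferentiableAt ℝ Y y)
    (hY : LipschitzOnWith K Y (closedBall x R))
    (hY' : LipschitzOnWith C (fderiv ℝ Y) (closedBall x R))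
    (hK : ∀ y ∈ closedBall x R, ‖fderiv ℝ Y y‖ ≤ K)
    (hXY : ∀ y ∈ closedBall x R, lieBracket ℝ X Y y = 0)
    {u : ℝ → ℝ → E} (hu : ∀ s ∈ Icc 0 r, ∀ t ∈ Icc 0 r, u s t ∈ closedBall x R)
    (hut : ∀ s ∈ Icc 0 r, ∀ t ∈ Icc 0 r, HasDerivWithinAt (u s) (Y (u s t)) (Icc 0 r) t)
    (hus : ∀ s ∈ Icc 0 r, HasDerivWithinAt (fun s => u s 0) (X (u s 0)) (Icc 0 r) s)
    {s t : ℝ} (hs : s ∈ Icc 0 r) (ht : t ∈ Icc 0 r) :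
    HasDerivWithinAt (fun s => u s t) (X (u s t)) (Icc 0 r) s := by
  have h0 : (0 : ℝ) ∈ Icc 0 r := left_mem_Icc.2 hr
  have hright : ∀ {f : ℝ → E} {f' : E} {τ : ℝ}, τ ∈ Ico 0 r →
      HasDerivWithinAt f f' (Icc 0 r) τ → HasDerivWithinAt f f' (Ici τ) τ := fun hτ hf =>
    hf.mono_of_mem_nhdsWithin (Icc_mem_nhdsGE_of_mem hτ)
  have hcont : ∀ s ∈ Icc 0 r, ContinuousOn (u s) (Icc 0 r) := fun s hs t ht =>
    (hut s hs t ht).continuousWithinAt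
  set e := Real.exp (K * r) with he
  have hdist : ∀ s' ∈ Icc 0 r, ∀ τ ∈ Icc 0 r, ‖u s' τ - u s τ‖ ≤ ‖u s' 0 - u s 0‖ * e := by
    intro s' hs' τ hτ
    have := dist_le_of_trajectories_ODE_of_mem (v := fun _ => Y) (s := fun _ => closedBall x R)
      (K := K) (fun _ _ => hY)
      (hcont s' hs') (fun t ht => hright ht (hut s' hs' t (Ico_subset_Icc_self ht)))
      (fun t ht => hu s' hs' t (Ico_subset_Icc_self ht))
      (hcont s hs) (fun t ht => hright ht (hut s hs t (Ico_subset_Icc_self ht)))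
      (fun t ht => hu s hs t (Ico_subset_Icc_self ht)) le_rfl τ hτ
    rw [dist_eq_norm, dist_eq_norm] at this
    refine this.trans ?_
    rw [he]
    have := hτ.2
    gcongr
    linarith
  -- `z` is the first-order error. Since `[X, Y] = 0`, `X` along the curve `u s` solves the
  -- linearization of the equation for `Y`, so `z` solves it up to a quadratic term.
  set z : ℝ → ℝ → E := fun s' τ => u s' τ - u s τ - (s' - s) • X (u s τ) with hz
  have hzd : ∀ s' ∈ Icc 0 r, ∀ τ ∈ Icc 0 r, HasDerivWithinAt (z s')
      (Y (u s' τ) - Y (u s τ) - (s' - s) • fderiv ℝ X (u s τ) (Y (u s τ))) (Icc 0 r) τ := by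
    intro s' hs' τ hτ
    refine ((hut s' hs' τ hτ).sub (hut s hs τ hτ)).sub (HasDerivWithinAt.const_smul (s' - s) ?_)
    exact (hXd _ (hu s hs τ hτ)).hasFDerivAt.comp_hasDerivWithinAt τ (hut s hs τ hτ)
  -- The rate `K + 1` in place of `K` is nonzero, which the exponential form of the Gronwall bound
  -- needs.
  have hbd : ∀ s' ∈ Icc 0 r, ∀ τ ∈ Icc 0 r,
      ‖Y (u s' τ) - Y (u s τ) - (s' - s) • fderiv ℝ X (u s τ) (Y (u s τ))‖ ≤
        (K + 1) * ‖z s' τ‖ + C * e ^ 2 * ‖u s' 0 - u s 0‖ ^ 2 := by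
    intro s' hs' τ hτ
    have h1 : fderiv ℝ X (u s τ) (Y (u s τ)) = fderiv ℝ Y (u s τ) (X (u s τ)) :=
      (sub_eq_zero.1 (hXY _ (hu s hs τ hτ))).symm
    have h2 : Y (u s' τ) - Y (u s τ) - (s' - s) • fderiv ℝ X (u s τ) (Y (u s τ)) =
        (Y (u s' τ) - Y (u s τ) - fderiv ℝ Y (u s τ) (u s' τ - u s τ)) +
          fderiv ℝ Y (u s τ) (z s' τ) := by
      rw [h1, hz]; simp only [map_sub, map_smul]; abel
    have h3 : ‖Y (u s' τ) - Y (u s τ) - fderiv ℝ Y (u s τ) (u s' τ - u s τ)‖ ≤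
        C * ‖u s' τ - u s τ‖ * ‖u s' τ - u s τ‖ := by
      have hseg : segment ℝ (u s τ) (u s' τ) ⊆ closedBall x R :=
        (convex_closedBall x R).segment_subset (hu s hs τ hτ) (hu s' hs' τ hτ)
      refine Convex.norm_image_sub_le_of_norm_fderiv_le' (𝕜 := ℝ)
        (fun y hy => hYd y (hseg hy)) (fun y hy => ?_) (convex_segment _ _)
        (left_mem_segment ℝ _ _) (right_mem_segment ℝ _ _)
      have := hY'.dist_le_mul y (hseg hy) _ (hu s hs τ hτ)
      rw [dist_eq_norm, dist_eq_norm] at this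
      refine this.trans ?_
      gcongr
      obtain ⟨θ, hθ, rfl⟩ := (segment_eq_image' ℝ (u s τ) (u s' τ)) ▸ hy
      rw [add_sub_cancel_left, norm_smul, Real.norm_of_nonneg hθ.1]
      exact mul_le_of_le_one_left (norm_nonneg _) hθ.2
    have h4 : ‖fderiv ℝ Y (u s τ) (z s' τ)‖ ≤ K * ‖z s' τ‖ :=
      ((fderiv ℝ Y (u s τ)).le_opNorm _).trans
        (mul_le_mul_of_nonneg_right (hK _ (hu s hs τ hτ)) (norm_nonneg _))
    have h5 : C * ‖u s' τ - u s τ‖ * ‖u s' τ - u s τ‖ ≤ C * e ^ 2 * ‖u s' 0 - u s 0‖ ^ 2 := by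
      have := hdist s' hs' τ hτ
      calc C * ‖u s' τ - u s τ‖ * ‖u s' τ - u s τ‖ = C * ‖u s' τ - u s τ‖ ^ 2 := by ring
        _ ≤ C * (‖u s' 0 - u s 0‖ * e) ^ 2 := by gcongr
        _ = _ := by ring
    rw [h2]
    have := norm_add_le (Y (u s' τ) - Y (u s τ) - fderiv ℝ Y (u s τ) (u s' τ - u s τ))
      (fderiv ℝ Y (u s τ) (z s' τ))
    have := norm_nonneg (z s' τ)
    linarith
  set e' := Real.exp ((K + 1) * t) with he'
  have hgr : ∀ s' ∈ Icc 0 r, ‖z s' t‖ ≤ ‖z s' 0‖ * e' +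
      C * e ^ 2 * ‖u s' 0 - u s 0‖ ^ 2 * ((e' - 1) / (K + 1)) := by
    intro s' hs'
    have := norm_le_gronwallBound_of_norm_deriv_right_le (f := z s')
      (fun τ hτ => (hzd s' hs' τ hτ).continuousWithinAt)
      (fun τ hτ => hright hτ (hzd s' hs' τ (Ico_subset_Icc_self hτ))) le_rfl
      (fun τ hτ => hbd s' hs' τ (Ico_subset_Icc_self hτ)) t ht
    rw [gronwallBound_of_K_ne_0 (by positivity), sub_zero] at this
    refine this.trans (le_of_eq ?_)
    rw [he']; ring
  rw [hasDerivWithinAt_iff_isLittleO]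
  have hz0 : (fun s' => z s' 0) =o[𝓝[Icc 0 r] s] fun s' => s' - s :=
    hasDerivWithinAt_iff_isLittleO.1 (hus s hs)
  have hu0 : (fun s' => u s' 0 - u s 0) =O[𝓝[Icc 0 r] s] fun s' => s' - s :=
    (hus s hs).isBigO_sub.comp_tendsto (Filter.tendsto_id.prodMk Filter.tendsto_const_pure)
  have hto : Filter.Tendsto (fun s' => s' - s) (𝓝[Icc 0 r] s) (𝓝 0) := by
    have : ContinuousAt (fun s' : ℝ => s' - s) s := by fun_prop
    simpa using this.tendsto.mono_left nhdsWithin_le_nhds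
  have hsq : (fun s' => ‖u s' 0 - u s 0‖ ^ 2) =o[𝓝[Icc 0 r] s] fun s' => s' - s := by
    have h1 : (fun s' => ‖u s' 0 - u s 0‖ ^ 2) =O[𝓝[Icc 0 r] s] fun s' => (s' - s) ^ 2 :=
      hu0.norm_left.pow 2
    refine h1.trans_isLittleO ?_
    simpa [Function.comp_def] using (Asymptotics.isLittleO_pow_id one_lt_two).comp_tendsto hto
  refine Asymptotics.IsBigO.trans_isLittleO (g := fun s' => ‖z s' 0‖ * e' +
      C * e ^ 2 * ‖u s' 0 - u s 0‖ ^ 2 * ((e' - 1) / (K + 1))) ?_ ?_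
  · refine Asymptotics.IsBigO.of_bound 1 ?_
    filter_upwards [self_mem_nhdsWithin] with s' hs'
    rw [one_mul]
    exact (hgr s' hs').trans (le_abs_self _)
  · refine Asymptotics.IsLittleO.add ?_ ?_
    · simpa [mul_comm] using hz0.norm_left.const_mul_left e'
    · refine (hsq.const_mul_left (C * e ^ 2 * ((e' - 1) / (K + 1)))).congr_left fun s' => ?_
      ring

/-- Commuting vector fields bounded by `B` are the coordinate fields of a parametrized square. -/
lemma exists_square_of_lieBracket_eq_zero [FiniteDimensional ℝ E] {X Y : E → E} {x : E}
    {R B r : ℝ} {O : Set E} (hO : IsOpen O) (hRO : closedBall x R ⊆ O) (hR : 0 ≤ R) (hr : 0 ≤ r)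
    (hB : 0 ≤ B) (hBr : 2 * (B * r) ≤ R)
    (hX : ContDiffOn ℝ 2 X O) (hY : ContDiffOn ℝ 2 Y O)
    (hXB : ∀ y ∈ closedBall x R, ‖X y‖ ≤ B) (hYB : ∀ y ∈ closedBall x R, ‖Y y‖ ≤ B)
    (hXY : ∀ y ∈ closedBall x R, lieBracket ℝ X Y y = 0) :
    ∃ u : ℝ → ℝ → E, ∀ s ∈ Icc 0 r, ∀ t ∈ Icc 0 r, u s t ∈ closedBall x R ∧
      HasDerivWithinAt (fun s => u s t) (X (u s t)) (Icc 0 r) s ∧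
      HasDerivWithinAt (u s) (Y (u s t)) (Icc 0 r) t := by
  have : CompleteSpace E := FiniteDimensional.complete ℝ E
  have hd : ∀ {Z : E → E}, ContDiffOn ℝ 2 Z O → ∀ y ∈ closedBall x R, DifferentiableAt ℝ Z y :=
    fun hZ y hy => (hZ.differentiableOn two_ne_zero).differentiableAt (hO.mem_nhds (hRO hy))
  have hl : ∀ {Z : E → E}, ContDiffOn ℝ 2 Z O → ∃ K, LipschitzOnWith K Z (closedBall x R) :=
    fun hZ => exists_lipschitzOnWith_closedBall hO hRO (hZ.of_le one_le_two)
  have hl' : ∀ {Z : E → E}, ContDiffOn ℝ 2 Z O →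
      ∃ K, LipschitzOnWith K (fderiv ℝ Z) (closedBall x R) := fun hZ =>
    exists_lipschitzOnWith_closedBall hO hRO (hZ.fderiv_of_isOpen hO (by norm_num))
  obtain ⟨KX, hKX⟩ := hl hX
  obtain ⟨KY, hKY⟩ := hl hY
  obtain ⟨CY, hCY⟩ := hl' hY
  have : ProperSpace E := FiniteDimensional.proper ℝ E
  obtain ⟨K', hK'⟩ := (isCompact_closedBall x R).exists_bound_of_continuousOn hCY.continuousOn
  -- The bottom edge follows `X` from `x` and uses half of the radius; the other half is left for
  -- the curves of `Y` that start on it.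
  obtain ⟨a, ha0, ha⟩ := exists_integralCurve_mem_closedBall (r := r) (R := R / 2) (ρ := 0)
    (p := x) (B := B)
    (hKX.mono (closedBall_subset_closedBall (half_le_self hR)))
    (fun y hy => hXB y (closedBall_subset_closedBall (half_le_self hR) hy)) hr le_rfl (by linarith)
    hB (by linarith) (by simp)
  have hex : ∀ s : ℝ, ∃ α : ℝ → E, s ∈ Icc 0 r → α 0 = a s ∧ ∀ t ∈ Icc 0 r,
      α t ∈ closedBall x R ∧ HasDerivWithinAt α (Y (α t)) (Icc 0 r) t := by
    intro s
    by_cases hs : s ∈ Icc 0 r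
    · obtain ⟨α, h⟩ := exists_integralCurve_mem_closedBall (r := r) hKY hYB hr
        (by linarith : 0 ≤ R / 2) hR hB (by linarith) (ha s hs).1
      exact ⟨α, fun _ => h⟩
    · exact ⟨fun _ => 0, fun h => absurd h hs⟩
  choose u hu using hex
  refine ⟨u, fun s hs t ht => ⟨((hu s hs).2 t ht).1, ?_, ((hu s hs).2 t ht).2⟩⟩
  refine hasDerivWithinAt_integralCurves_of_lieBracket_eq_zero (K := max KY K'.toNNReal)
    hr (hd hX) (hd hY) (hKY.weaken (le_max_left _ _)) hCY (fun y hy => ?_) hXY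
    (fun s hs t ht => ((hu s hs).2 t ht).1) (fun s hs t ht => ((hu s hs).2 t ht).2)
    (fun s hs => ?_) hs ht
  · refine (hK' y hy).trans ((Real.le_coe_toNNReal K').trans ?_)
    exact_mod_cast le_max_right _ _
  · have h1 : ∀ s' ∈ Icc 0 r, u s' 0 = a s' := fun s' hs' => (hu s' hs').1
    rw [h1 s hs]
    exact (ha s hs).2.congr_of_mem h1 hs

end Flat

/-! ### `C⁰`-rigidity of commutation -/

section Flat

open Metric VectorField

variable {E : Type*} [NormedAddCommGroup E] [NormedSpace ℝ E]

/-- The second difference of a square `u` with `∂ₛu = X'(u)`, `∂ₜu = Y'(u)` is governed by the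
derivative of any vector field which is close to `X'`. -/
lemma norm_secondDifference_sub_le {u : ℝ → ℝ → E} {X X' Y' : E → E} {r ε δ : ℝ} {c : E}
    (hr : 0 ≤ r)
    (hs : ∀ s ∈ Icc 0 r, ∀ t ∈ Icc 0 r,
      HasDerivWithinAt (fun s => u s t) (X' (u s t)) (Icc 0 r) s)
    (ht : ∀ s ∈ Icc 0 r, ∀ t ∈ Icc 0 r, HasDerivWithinAt (u s) (Y' (u s t)) (Icc 0 r) t)
    (hX : ∀ s ∈ Icc 0 r, ∀ t ∈ Icc 0 r, DifferentiableAt ℝ X (u s t))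
    (hε : ∀ s ∈ Icc 0 r, ∀ t ∈ Icc 0 r, ‖X' (u s t) - X (u s t)‖ ≤ ε)
    (hδ : ∀ s ∈ Icc 0 r, ∀ t ∈ Icc 0 r, ‖fderiv ℝ X (u s t) (Y' (u s t)) - c‖ ≤ δ) :
    ‖u r r - u r 0 - u 0 r + u 0 0 - r ^ 2 • c‖ ≤ (δ * r + 2 * ε) * r := by
  have h0 : (0 : ℝ) ∈ Icc 0 r := left_mem_Icc.2 hr
  have h1 : r ∈ Icc 0 r := right_mem_Icc.2 hr
  have hid : ∀ (c : E) (t : ℝ), HasDerivWithinAt (fun t : ℝ => t • c) c (Icc 0 r) t := fun c t => by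
    simpa using (hasDerivWithinAt_id t (Icc 0 r)).smul_const c
  have hinner : ∀ s ∈ Icc 0 r, ‖X (u s r) - X (u s 0) - r • c‖ ≤ δ * r := by
    intro s hs'
    have := norm_image_sub_le_of_norm_deriv_le_segment' (a := 0) (b := r) (C := δ)
      (f := fun t => X (u s t) - t • c) (f' := fun t => fderiv ℝ X (u s t) (Y' (u s t)) - c)
      (fun t ht' => ((hX s hs' t ht').hasFDerivAt.comp_hasDerivWithinAt t
        (ht s hs' t ht')).sub (hid c t))
      (fun t ht' => hδ s hs' t (Ico_subset_Icc_self ht')) r h1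
    simp only [zero_smul, sub_zero] at this
    rwa [sub_right_comm] at this
  -- The `s`-derivative involves only values of `X'` at the two ends, so replacing `X'` by `X` costs
  -- `2 * ε` and no derivative of `X'`.
  have := norm_image_sub_le_of_norm_deriv_le_segment' (a := 0) (b := r) (C := δ * r + 2 * ε)
    (f := fun s => u s r - u s 0 - s • (r • c)) (f' := fun s => X' (u s r) - X' (u s 0) - r • c)
    (fun s hs' => ((hs s hs' r h1).sub (hs s hs' 0 h0)).sub (hid (r • c) s))
    (fun s hs' => ?_) r h1
  · simp only [zero_smul, sub_zero] at this
    refine le_of_eq_of_le (congrArg _ ?_) this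
    rw [smul_smul, ← pow_two]; abel
  · have hs'' := Ico_subset_Icc_self hs'
    have e : X' (u s r) - X' (u s 0) - r • c = (X (u s r) - X (u s 0) - r • c) +
        (X' (u s r) - X (u s r)) - (X' (u s 0) - X (u s 0)) := by abel
    rw [e]
    have a1 := norm_sub_le ((X (u s r) - X (u s 0) - r • c) + (X' (u s r) - X (u s r)))
      (X' (u s 0) - X (u s 0))
    have a2 := norm_add_le (X (u s r) - X (u s 0) - r • c) (X' (u s r) - X (u s r))
    have a3 := hinner s hs''
    have a4 := hε s hs'' r h1
    have a5 := hε s hs'' 0 h0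
    linarith

/-- `C⁰`-rigidity of commutation: vector fields which do not commute at a point are not `C⁰`-close
to commuting ones. -/
theorem exists_lieBracket_ne_zero_of_norm_sub_le [FiniteDimensional ℝ E] {X Y : E → E} {x : E}
    {O : Set E} (hO : IsOpen O) (hxO : x ∈ O) (hX : ContDiffOn ℝ 1 X O) (hY : ContDiffOn ℝ 1 Y O)
    (hXY : lieBracket ℝ X Y x ≠ 0) :
    ∃ ε > 0, ∀ X' Y' : E → E, ContDiffOn ℝ 2 X' O → ContDiffOn ℝ 2 Y' O →
      (∀ y ∈ O, ‖X' y - X y‖ ≤ ε) → (∀ y ∈ O, ‖Y' y - Y y‖ ≤ ε) →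
      ∃ y ∈ O, lieBracket ℝ X' Y' y ≠ 0 := by
  have hOx := hO.mem_nhds hxO
  set c := fderiv ℝ X x (Y x) with hc
  set c' := fderiv ℝ Y x (X x) with hc'
  have hcc : 0 < ‖c - c'‖ := by
    rw [norm_pos_iff, sub_ne_zero]
    exact fun h => hXY (sub_eq_zero.2 h.symm)
  -- Each of the two estimates of the second difference will have error `2 * δ * r ^ 2`; together
  -- this is half of `r ^ 2 * ‖c - c'‖`.
  set δ := ‖c - c'‖ / 8 with hδ
  have hδ0 : 0 < δ := by positivity
  have key : ∀ {Z : E → E} (w : E), ContDiffOn ℝ 1 Z O → ∀ᶠ p : E × E in 𝓝 (x, w),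
      ‖fderiv ℝ Z p.1 p.2 - fderiv ℝ Z x w‖ ≤ δ := by
    intro Z w hZ
    have h1 : ContinuousAt (fderiv ℝ Z) x :=
      (hZ.continuousOn_fderiv_of_isOpen hO le_rfl).continuousAt hOx
    have h2 : ContinuousAt (fun p : E × E => fderiv ℝ Z p.1 p.2) (x, w) :=
      (ContinuousAt.comp (x := ((x, w) : E × E)) h1 continuousAt_fst).clm_apply continuousAt_snd
    have h3 := h2.eventually (closedBall_mem_nhds _ hδ0)
    filter_upwards [h3] with p hp
    rwa [dist_eq_norm] at hp
  have hprod : ∀ {w : E} {P : E × E → Prop}, (∀ᶠ p in 𝓝 (x, w), P p) →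
      ∃ ρ > 0, ∀ y ∈ closedBall x ρ, ∀ v ∈ closedBall w ρ, P (y, v) := by
    intro w P hP
    obtain ⟨ρ, hρ, h⟩ := Metric.nhds_basis_closedBall.eventually_iff.1 hP
    exact ⟨ρ, hρ, fun y hy v hv => h (by rw [← closedBall_prod_same]; exact ⟨hy, hv⟩)⟩
  obtain ⟨ρ₁, hρ₁, h₁⟩ := hprod (key (Y x) hX)
  obtain ⟨ρ₂, hρ₂, h₂⟩ := hprod (key (X x) hY)
  set ρ := min ρ₁ ρ₂
  have hρ : 0 < ρ := lt_min hρ₁ hρ₂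
  have hcts : ∀ {Z : E → E}, ContDiffOn ℝ 1 Z O → ∀ᶠ y in 𝓝 x, dist (Z y) (Z x) ≤ ρ / 2 :=
    fun hZ => (hZ.continuousOn.continuousAt hOx).eventually (closedBall_mem_nhds _ (half_pos hρ))
  obtain ⟨R₀, hR₀, hR⟩ := Metric.nhds_basis_closedBall.eventually_iff.1
    ((hcts hX).and ((hcts hY).and hOx))
  set R := min R₀ ρ
  have hR0 : 0 < R := lt_min hR₀ hρ
  have hball : closedBall x R ⊆ closedBall x R₀ := closedBall_subset_closedBall (min_le_left _ _)
  have hballO : closedBall x R ⊆ O := fun y hy => (hR (hball hy)).2.2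
  set B := max ‖X x‖ ‖Y x‖ + ρ with hB
  have hB0 : 0 < B := by positivity
  -- The side depends on `X`, `Y` and `O` alone, so it may enter the choice of `ε`.
  set r := R / (2 * B) with hr
  have hr0 : 0 < r := by positivity
  -- `ρ / 2` keeps the values of `X'`, `Y'` within `ρ` of `X x`, `Y x`; `δ * r / 2` makes the
  -- replacement cost at most `δ * r`.
  refine ⟨min (ρ / 2) (δ * r / 2), by positivity, fun X' Y' hX' hY' hXX hYY => ?_⟩
  by_contra! hcomm
  have hnear : ∀ {Z Z' : E → E}, (∀ y ∈ O, ‖Z' y - Z y‖ ≤ min (ρ / 2) (δ * r / 2)) →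
      ∀ y ∈ closedBall x R, dist (Z y) (Z x) ≤ ρ / 2 → Z' y ∈ closedBall (Z x) ρ := by
    intro Z Z' h y hy hy'
    have h1 := (h y (hballO hy)).trans (min_le_left _ _)
    rw [← dist_eq_norm] at h1
    rw [mem_closedBall]
    linarith [dist_triangle (Z' y) (Z y) (Z x)]
  have hXn : ∀ y ∈ closedBall x R, X' y ∈ closedBall (X x) ρ := fun y hy =>
    hnear hXX y hy (hR (hball hy)).1
  have hYn : ∀ y ∈ closedBall x R, Y' y ∈ closedBall (Y x) ρ := fun y hy =>
    hnear hYY y hy (hR (hball hy)).2.1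
  have hbd : ∀ {v w : E}, v ∈ closedBall w ρ → ‖w‖ ≤ max ‖X x‖ ‖Y x‖ → ‖v‖ ≤ B := fun hv hw =>
    (norm_le_of_mem_closedBall hv).trans (by rw [hB]; gcongr)
  obtain ⟨u, hu⟩ := exists_square_of_lieBracket_eq_zero (x := x) (B := B) hO hballO hR0.le hr0.le
    hB0.le (le_of_eq (by rw [hr]; field_simp)) hX' hY'
    (fun y hy => hbd (hXn y hy) (le_max_left _ _)) (fun y hy => hbd (hYn y hy) (le_max_right _ _))
    (fun y hy => hcomm y (hballO hy))
  have hd : ∀ {Z : E → E}, ContDiffOn ℝ 1 Z O → ∀ y ∈ closedBall x R, DifferentiableAt ℝ Z y :=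
    fun hZ y hy => (hZ.differentiableOn one_ne_zero).differentiableAt (hO.mem_nhds (hballO hy))
  have hb₁ : closedBall x R ⊆ closedBall x ρ₁ := closedBall_subset_closedBall
    ((min_le_right _ _).trans (min_le_left _ _))
  have hb₂ : closedBall x R ⊆ closedBall x ρ₂ := closedBall_subset_closedBall
    ((min_le_right _ _).trans (min_le_right _ _))
  have e1 := norm_secondDifference_sub_le (X := X) (c := c) (δ := δ) (ε := δ * r / 2) hr0.le
    (fun s hs t ht => (hu s hs t ht).2.1) (fun s hs t ht => (hu s hs t ht).2.2)
    (fun s hs t ht => hd hX _ (hu s hs t ht).1)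
    (fun s hs t ht => (hXX _ (hballO (hu s hs t ht).1)).trans (min_le_right _ _))
    (fun s hs t ht => h₁ _ (hb₁ (hu s hs t ht).1) _
      (closedBall_subset_closedBall (min_le_left _ _) (hYn _ (hu s hs t ht).1)))
  -- The second difference is symmetric in `s` and `t`, so the transposed square estimates the same
  -- vector with the roles of the fields exchanged.
  have e2 := norm_secondDifference_sub_le (u := fun t s => u s t) (X := Y) (c := c') (δ := δ)
    (ε := δ * r / 2) hr0.le
    (fun s hs t ht => (hu t ht s hs).2.2) (fun s hs t ht => (hu t ht s hs).2.1)
    (fun s hs t ht => hd hY _ (hu t ht s hs).1)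
    (fun s hs t ht => (hYY _ (hballO (hu t ht s hs).1)).trans (min_le_right _ _))
    (fun s hs t ht => h₂ _ (hb₂ (hu t ht s hs).1) _
      (closedBall_subset_closedBall (min_le_right _ _) (hXn _ (hu t ht s hs).1)))
  have e3 : r ^ 2 • (c - c') = (u r r - u 0 r - u r 0 + u 0 0 - r ^ 2 • c') -
      (u r r - u r 0 - u 0 r + u 0 0 - r ^ 2 • c) := by rw [smul_sub]; abel
  have e4 : ‖r ^ 2 • (c - c')‖ ≤ 2 * ((δ * r + 2 * (δ * r / 2)) * r) := by
    rw [e3]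
    refine (norm_sub_le _ _).trans ?_
    linarith
  rw [norm_smul, Real.norm_of_nonneg (by positivity)] at e4
  have e5 : ‖c - c'‖ = 8 * δ := by rw [hδ]; ring
  rw [e5] at e4
  nlinarith [mul_pos hδ0 (pow_pos hr0 2)]

/-! ### Integrable distributions close to a field of projections -/

/-- A constant vector lifts smoothly along `V₀` to the kernel of a submersion transverse
to `V₀`. -/
lemma exists_contDiffAt_lift_ker [FiniteDimensional ℝ E] {F : Type*} [NormedAddCommGroup F]
    [NormedSpace ℝ F] [FiniteDimensional ℝ F] {V₀ : Submodule ℝ E}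
    (hdim : Module.finrank ℝ V₀ = Module.finrank ℝ F) {ψ : E → F} {y : E}
    (hψ : ContDiffAt ℝ ∞ ψ y)
    (hker : ∀ᶠ z in 𝓝 y, ∀ v ∈ V₀, fderiv ℝ ψ z v = 0 → v = 0) (v : E) :
    ∃ Z : E → E, ContDiffAt ℝ 2 Z y ∧
      ∀ᶠ z in 𝓝 y, fderiv ℝ ψ z (Z z) = 0 ∧ v - Z z ∈ V₀ := by
  have : CompleteSpace V₀ := FiniteDimensional.complete ℝ V₀
  set B : E → V₀ →L[ℝ] F := fun z => (fderiv ℝ ψ z).comp V₀.subtypeL with hB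
  have hdψ : ContDiffAt ℝ 2 (fderiv ℝ ψ) y := hψ.fderiv_right (show ((2 : ℕ∞) + 1 : WithTop ℕ∞) ≤ ∞ by exact_mod_cast le_top)
  have hBs : ContDiffAt ℝ 2 B y := hdψ.clm_comp contDiffAt_const
  have hinv : ∀ z, (∀ v ∈ V₀, fderiv ℝ ψ z v = 0 → v = 0) → (B z).IsInvertible := by
    intro z hz
    have hinj : Function.Injective (B z : V₀ →ₗ[ℝ] F) := by
      rw [injective_iff_map_eq_zero]
      intro w hw
      exact Subtype.ext (hz w w.2 hw)
    refine ⟨(LinearEquiv.ofInjectiveOfFinrankEq _ hinj hdim).toContinuousLinearEquiv, ?_⟩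
    ext w
    rfl
  -- The correction is the unique element of `V₀` with the same image as `v` under `dψ`; it depends
  -- smoothly on `z` because inversion of operators is smooth.
  refine ⟨fun z => v - V₀.subtypeL ((B z).inverse (fderiv ℝ ψ z v)), ?_, ?_⟩
  · obtain ⟨e, he⟩ := hinv y hker.self_of_nhds
    have h1 : ContDiffAt ℝ 2 (fun z => (B z).inverse) y :=
      by
      have h2 : ContDiffAt ℝ 2 ContinuousLinearMap.inverse (B y) := he ▸ contDiffAt_map_inverse e
      exact h2.comp y hBs
    exact contDiffAt_const.sub (V₀.subtypeL.contDiff.contDiffAt.comp y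
      (h1.clm_apply (hdψ.clm_apply contDiffAt_const)))
  · filter_upwards [hker] with z hz
    obtain ⟨e, he⟩ := hinv z hz
    refine ⟨?_, by simp⟩
    have h2 : fderiv ℝ ψ z (V₀.subtypeL ((B z).inverse (fderiv ℝ ψ z v))) =
        B z ((B z).inverse (fderiv ℝ ψ z v)) := rfl
    rw [map_sub, h2, ← he, ContinuousLinearMap.inverse_equiv]
    simp

/-- The bracket of two fields in the kernel of `dψ` is in the kernel of `dψ`. -/
lemma fderiv_lieBracket_eq_zero {F : Type*} [NormedAddCommGroup F] [NormedSpace ℝ F] {ψ : E → F}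
    {X Y : E → E} {y : E} (hψ : ContDiffAt ℝ ∞ ψ y) (hX : DifferentiableAt ℝ X y)
    (hY : DifferentiableAt ℝ Y y) (hψX : ∀ᶠ z in 𝓝 y, fderiv ℝ ψ z (X z) = 0)
    (hψY : ∀ᶠ z in 𝓝 y, fderiv ℝ ψ z (Y z) = 0) :
    fderiv ℝ ψ y (lieBracket ℝ X Y y) = 0 := by
  have hd : DifferentiableAt ℝ (fderiv ℝ ψ) y :=
    (hψ.fderiv_right (m := 1) (show ((1 : ℕ∞) + 1 : WithTop ℕ∞) ≤ ∞ by exact_mod_cast le_top)).differentiableAt one_ne_zero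
  -- Differentiating `dψ(Z) = 0` trades the derivative of `Z` for the second derivative of `ψ`,
  -- whose symmetry makes the two terms of the bracket cancel.
  have key : ∀ {Z : E → E}, DifferentiableAt ℝ Z y → (∀ᶠ z in 𝓝 y, fderiv ℝ ψ z (Z z) = 0) →
      ∀ a, fderiv ℝ ψ y (fderiv ℝ Z y a) = - fderiv ℝ (fderiv ℝ ψ) y a (Z y) := by
    intro Z hZ h a
    have h1 : HasFDerivAt (fun z => fderiv ℝ ψ z (Z z)) (0 : E →L[ℝ] F) y :=
      (hasFDerivAt_const (0 : F) y).congr_of_eventuallyEq h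
    have h2 := congrArg (fun A : E →L[ℝ] F => A a)
      (h1.unique (hd.hasFDerivAt.clm_apply hZ.hasFDerivAt))
    simp only [zero_apply, add_apply,
      ContinuousLinearMap.comp_apply, ContinuousLinearMap.flip_apply] at h2
    exact eq_neg_of_add_eq_zero_left h2.symm
  have hsymm : IsSymmSndFDerivAt ℝ ψ y := hψ.isSymmSndFDerivAt (by simpa using (show ((2 : ℕ∞) : WithTop ℕ∞) ≤ ∞ by exact_mod_cast le_top))
  rw [lieBracket_eq]
  simp only [map_sub]
  rw [key hX hψX, key hY hψY, hsymm.eq (X y) (Y y), sub_self]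

/-- A smooth field of projections `L` with kernel `V₀` whose range is not involutive at `x` is not
`C⁰`-close to an integrable distribution. -/
theorem exists_norm_sub_gt_of_integrable [FiniteDimensional ℝ E] {F : Type*}
    [NormedAddCommGroup F] [NormedSpace ℝ F] [FiniteDimensional ℝ F] {V₀ : Submodule ℝ E}
    (hdim : Module.finrank ℝ V₀ = Module.finrank ℝ F) {O : Set E} (hO : IsOpen O) {x : E}
    (hxO : x ∈ O) {L : E → E →L[ℝ] E} (hL : ContDiffOn ℝ 1 L O)
    (hLV : ∀ y ∈ O, ∀ v ∈ V₀, L y v = 0) (hLsub : ∀ y ∈ O, ∀ v, v - L y v ∈ V₀)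
    {X Y : E → E} (hX : DifferentiableAt ℝ X x) (hY : DifferentiableAt ℝ Y x)
    (hLX : ∀ᶠ y in 𝓝 x, L y (X y) = X y) (hLY : ∀ᶠ y in 𝓝 x, L y (Y y) = Y y)
    (hXY : L x (lieBracket ℝ X Y x) ≠ lieBracket ℝ X Y x) :
    ∃ ε > 0, ∀ D : E → Submodule ℝ E,
      (∀ y ∈ O, ∃ ψ : E → F, ContDiffAt ℝ ∞ ψ y ∧
        ∀ᶠ z in 𝓝 y, ∀ v, v ∈ D z ↔ fderiv ℝ ψ z v = 0) →
      ∃ y ∈ O, ∃ v ∈ D y, ε * ‖v‖ < ‖v - L y v‖ := by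
  have hOx := hO.mem_nhds hxO
  have hLd : DifferentiableAt ℝ L x :=
    (hL.differentiableOn one_ne_zero).differentiableAt hOx
  have key : ∀ {Z : E → E}, DifferentiableAt ℝ Z x → (∀ᶠ y in 𝓝 x, L y (Z y) = Z y) →
      ∀ a, fderiv ℝ Z x a = fderiv ℝ L x a (Z x) + L x (fderiv ℝ Z x a) := by
    intro Z hZ h a
    have h1 : HasFDerivAt (fun z => L z (Z z)) (fderiv ℝ Z x) x :=
      hZ.hasFDerivAt.congr_of_eventuallyEq h
    have h2 := congrArg (fun A : E →L[ℝ] E => A a)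
      (h1.unique (hLd.hasFDerivAt.clm_apply hZ.hasFDerivAt))
    simp only [add_apply,
      ContinuousLinearMap.comp_apply, ContinuousLinearMap.flip_apply] at h2
    exact h2.trans (add_comm _ _)
  have hfd : ∀ v a, fderiv ℝ (fun y => L y v) x a = fderiv ℝ L x a v := by
    intro v a
    have := hLd.hasFDerivAt.clm_apply (hasFDerivAt_const v x)
    rw [this.fderiv]
    simp
  -- By differentiating `L X = X` and `L Y = Y`, this bracket equals `[X, Y](x) - L x ([X, Y](x))`.
  have hbr : lieBracket ℝ (fun y => L y (X x)) (fun y => L y (Y x)) x ≠ 0 := by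
    have e1 := key hX hLX (Y x)
    have e2 := key hY hLY (X x)
    intro h
    apply hXY
    rw [lieBracket_eq] at h ⊢
    simp only [hfd, hLX.self_of_nhds, hLY.self_of_nhds] at h
    simp only [map_sub]
    rw [sub_eq_zero] at h
    nth_rw 2 [e1, e2]
    rw [h]
    abel
  obtain ⟨C, hC⟩ : ∃ C, ∀ᶠ y in 𝓝 x, ‖L y‖ ≤ C := by
    refine ⟨‖L x‖ + 1, ?_⟩
    have := (hL.continuousOn.continuousAt hOx).norm.eventually (Iic_mem_nhds (lt_add_one ‖L x‖))
    exact this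
  obtain ⟨O', hO'sub, hO', hxO'⟩ := _root_.eventually_nhds_iff.1 (hC.and hOx)
  have hC0 : 0 ≤ C := (norm_nonneg _).trans (hO'sub x hxO').1
  have hLv : ∀ v, ContDiffOn ℝ 1 (fun y => L y v) O' := fun v =>
    (hL.mono fun y hy => (hO'sub y hy).2).clm_apply contDiffOn_const
  obtain ⟨ε₀, hε₀, hmain⟩ :=
    exists_lieBracket_ne_zero_of_norm_sub_le hO' hxO' (hLv (X x)) (hLv (Y x)) hbr
  -- `1 / 2` forces `D` to meet `V₀` trivially and bounds a lift `Z` of `v` by `2 * ‖L y v‖`; the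
  -- second term then gives `ε * ‖Z y‖ ≤ ε₀`.
  set ε := min (1 / 2) (ε₀ / (2 * C * (‖X x‖ + ‖Y x‖) + 1)) with hε
  have hε0 : 0 < ε := by positivity
  refine ⟨ε, hε0, fun D hD => ?_⟩
  by_contra! hclose
  have hmem : ∀ v, v ∈ V₀ ↔ L x v = 0 := fun v =>
    ⟨hLV x hxO v, fun h => by simpa [h] using hLsub x hxO v⟩
  have hDV : ∀ y ∈ O, ∀ v ∈ V₀, v ∈ D y → v = 0 := by
    intro y hy v hv hvD
    have h1 := hclose y hy v hvD
    rw [hLV y hy v hv, sub_zero] at h1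
    have h2 : ε ≤ 1 / 2 := min_le_left _ _
    rw [← norm_eq_zero]
    nlinarith [norm_nonneg v]
  have hlift : ∀ v, ∀ y ∈ O, ∃ Z : E → E, ContDiffAt ℝ 2 Z y ∧
      ∀ᶠ z in 𝓝 y, Z z ∈ D z ∧ v - Z z ∈ V₀ := by
    intro v y hy
    obtain ⟨ψ, hψ, hψD⟩ := hD y hy
    obtain ⟨Z, hZ, hZD⟩ := exists_contDiffAt_lift_ker hdim hψ (by
      filter_upwards [hψD, hO.mem_nhds hy] with z hz hzO w hw hw0
      exact hDV z hzO w hw ((hz w).2 hw0)) v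
    exact ⟨Z, hZ, by
      filter_upwards [hψD, hZD] with z hz hz' using ⟨(hz _).2 hz'.1, hz'.2⟩⟩
  have hfield : ∀ v, ∃ Z : E → E, ContDiffOn ℝ 2 Z O ∧ ∀ y ∈ O, Z y ∈ D y ∧ v - Z y ∈ V₀ := by
    intro v
    have hex : ∀ y, ∃ w, y ∈ O → w ∈ D y ∧ v - w ∈ V₀ := by
      intro y
      by_cases hy : y ∈ O
      · obtain ⟨Z, -, hZ⟩ := hlift v y hy
        exact ⟨Z y, fun _ => hZ.self_of_nhds⟩
      · exact ⟨0, fun h => absurd h hy⟩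
    choose Z hZ using hex
    -- Pointwise choices are smooth: two lifts of `v` differ by an element of `D` and `V₀`, hence
    -- agree, so `Z` coincides with each local smooth lift.
    refine ⟨Z, fun y hy => ContDiffAt.contDiffWithinAt ?_, hZ⟩
    obtain ⟨Z', hZ'c, hZ'⟩ := hlift v y hy
    refine hZ'c.congr_of_eventuallyEq ?_
    filter_upwards [hZ', hO.mem_nhds hy] with z hz hzO
    refine sub_eq_zero.1 (hDV z hzO _ ?_ ((D z).sub_mem (hZ z hzO).1 hz.1))
    have := V₀.sub_mem hz.2 (hZ z hzO).2
    rwa [sub_sub_sub_cancel_left] at this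
  have hest : ∀ v, ‖v‖ ≤ ‖X x‖ + ‖Y x‖ → ∀ {Z : E → E}, (∀ y ∈ O, Z y ∈ D y ∧ v - Z y ∈ V₀) →
      ∀ y ∈ O', ‖Z y - L y v‖ ≤ ε₀ := by
    intro v hv Z hZ y hy
    have hyO := (hO'sub y hy).2
    have h1 : L y (Z y) = L y v := by
      have := hLV y hyO _ (hZ y hyO).2
      rw [map_sub, sub_eq_zero] at this
      exact this.symm
    have h2 := hclose y hyO _ (hZ y hyO).1
    rw [h1] at h2
    have h3 : ‖Z y‖ ≤ ‖L y v‖ + ‖Z y - L y v‖ := norm_le_insert' _ _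
    have h4 : ε ≤ 1 / 2 := min_le_left _ _
    have h5 : ‖L y v‖ ≤ C * (‖X x‖ + ‖Y x‖) :=
      ((L y).le_opNorm v).trans (mul_le_mul (hO'sub y hy).1 hv (norm_nonneg _) hC0)
    have h6 : ‖Z y‖ ≤ 2 * C * (‖X x‖ + ‖Y x‖) + 1 := by nlinarith [norm_nonneg (Z y)]
    refine h2.trans ((mul_le_mul (min_le_right _ _) h6 (norm_nonneg _) (by positivity)).trans ?_)
    rw [div_mul_cancel₀]
    positivity
  obtain ⟨X', hX'c, hX'⟩ := hfield (X x)
  obtain ⟨Y', hY'c, hY'⟩ := hfield (Y x)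
  have hO'O : O' ⊆ O := fun y hy => (hO'sub y hy).2
  obtain ⟨y, hy, hne⟩ := hmain X' Y' (hX'c.mono hO'O) (hY'c.mono hO'O)
    (hest _ (le_add_of_nonneg_right (norm_nonneg _)) hX')
    (hest _ (le_add_of_nonneg_left (norm_nonneg _)) hY')
  have hyO := hO'O hy
  apply hne
  have hdiff : ∀ {Z : E → E}, ContDiffOn ℝ 2 Z O → DifferentiableAt ℝ Z y := fun hZ =>
    (hZ.differentiableOn two_ne_zero).differentiableAt (hO.mem_nhds hyO)
  obtain ⟨ψ, hψ, hψD⟩ := hD y hyO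
  have hin : ∀ {v : E} {Z : E → E}, (∀ y ∈ O, Z y ∈ D y ∧ v - Z y ∈ V₀) →
      ∀ᶠ z in 𝓝 y, fderiv ℝ ψ z (Z z) = 0 := by
    intro v Z hZ
    filter_upwards [hψD, hO.mem_nhds hyO] with z hz hzO using (hz _).1 (hZ z hzO).1
  -- The bracket lies in `D` by integrability. It lies in `V₀` because `v - Z` has values in the
  -- constant subspace `V₀`, and hence so does the derivative of `Z`.
  refine hDV y hyO _ ?_ ((hψD.self_of_nhds _).2
    (fderiv_lieBracket_eq_zero hψ (hdiff hX'c) (hdiff hY'c) (hin hX') (hin hY')))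
  have hvert : ∀ {v : E} {Z : E → E}, ContDiffOn ℝ 2 Z O → (∀ y ∈ O, Z y ∈ D y ∧ v - Z y ∈ V₀) →
      ∀ a, fderiv ℝ Z y a ∈ V₀ := by
    intro v Z hZc hZ a
    rw [hmem]
    have h1 : HasFDerivAt (fun z => L x (Z z)) (0 : E →L[ℝ] E) y := by
      refine (hasFDerivAt_const (L x v) y).congr_of_eventuallyEq ?_
      filter_upwards [hO.mem_nhds hyO] with z hzO
      have := (hmem _).1 (hZ z hzO).2
      rw [map_sub, sub_eq_zero] at this
      exact this.symm
    have h2 := (L x).hasFDerivAt.comp y (hdiff hZc).hasFDerivAt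
    exact congrArg (fun A : E →L[ℝ] E => A a) (h2.unique h1)
  exact V₀.sub_mem (hvert hY'c hY' _) (hvert hX'c hX' _)

end Flat

/-! ### Vector fields and brackets in a chart -/

section Coordinates

open VectorField

variable {n : ℕ} {M : Type*} [TopologicalSpace M]
  [ChartedSpace (EuclideanSpace ℝ (Fin n)) M] [IsManifold (𝓡 n) ∞ M]

/-- The differential at `z` of the preferred chart at `x`. -/
noncomputable def chartDeriv (x z : M) :
    TangentSpace (𝓡 n) z →L[ℝ] EuclideanSpace ℝ (Fin n) :=
  mfderiv (𝓡 n) 𝓘(ℝ, EuclideanSpace ℝ (Fin n)) (extChartAt (𝓡 n) x) z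

/-- The differential at `y` of the inverse of the preferred chart at `x`. -/
noncomputable def chartSymmDeriv (x : M) (y : EuclideanSpace ℝ (Fin n)) :
    EuclideanSpace ℝ (Fin n) →L[ℝ] TangentSpace (𝓡 n) ((extChartAt (𝓡 n) x).symm y) :=
  mfderiv 𝓘(ℝ, EuclideanSpace ℝ (Fin n)) (𝓡 n) (extChartAt (𝓡 n) x).symm y

/-- The vector field `X` in the preferred chart at `x`. -/
noncomputable def coordField (x : M) (X : ∀ z : M, TangentSpace (𝓡 n) z)
    (y : EuclideanSpace ℝ (Fin n)) : EuclideanSpace ℝ (Fin n) :=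
  chartDeriv x ((extChartAt (𝓡 n) x).symm y) (X ((extChartAt (𝓡 n) x).symm y))

lemma chartDeriv_chartSymmDeriv {x : M} {y : EuclideanSpace ℝ (Fin n)}
    (hy : y ∈ (extChartAt (𝓡 n) x).target) (v : EuclideanSpace ℝ (Fin n)) :
    chartDeriv x ((extChartAt (𝓡 n) x).symm y) (chartSymmDeriv x y v) = v := by
  have h := mfderiv_extChartAt_comp_mfderivWithin_extChartAt_symm (I := 𝓡 n) hy
  rw [ModelWithCorners.Boundaryless.range_eq_univ, mfderivWithin_univ] at h
  exact congrArg (fun A : EuclideanSpace ℝ (Fin n) →L[ℝ] EuclideanSpace ℝ (Fin n) => A v) h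

lemma chartSymmDeriv_chartDeriv {x : M} {y : EuclideanSpace ℝ (Fin n)}
    (hy : y ∈ (extChartAt (𝓡 n) x).target)
    (v : TangentSpace (𝓡 n) ((extChartAt (𝓡 n) x).symm y)) :
    chartSymmDeriv x y (chartDeriv x ((extChartAt (𝓡 n) x).symm y) v) = v := by
  have h := mfderivWithin_extChartAt_symm_comp_mfderiv_extChartAt (I := 𝓡 n) hy
  rw [ModelWithCorners.Boundaryless.range_eq_univ, mfderivWithin_univ] at h
  exact congrArg (fun A : TangentSpace (𝓡 n) ((extChartAt (𝓡 n) x).symm y) →L[ℝ]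
    TangentSpace (𝓡 n) ((extChartAt (𝓡 n) x).symm y) => A v) h

lemma chartDeriv_bijective {x z : M} (hz : z ∈ (extChartAt (𝓡 n) x).source) :
    Function.Bijective (chartDeriv (n := n) x z) := by
  have hy := (extChartAt (𝓡 n) x).map_source hz
  rw [← (extChartAt (𝓡 n) x).left_inv hz]
  exact Function.bijective_iff_has_inverse.2
    ⟨chartSymmDeriv x _, chartSymmDeriv_chartDeriv hy, chartDeriv_chartSymmDeriv hy⟩

lemma contDiffOn_coordField {x : M} {X : ∀ z : M, TangentSpace (𝓡 n) z} {W : Set M}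
    (hX : ContMDiffOn (𝓡 n) (𝓡 n).tangent ∞
      (fun z => (⟨z, X z⟩ : TangentBundle (𝓡 n) M)) W) :
    ContDiffOn ℝ ∞ (coordField x X)
      ((extChartAt (𝓡 n) x).target ∩ (extChartAt (𝓡 n) x).symm ⁻¹' W) := by
  rw [← contMDiffOn_iff_contDiffOn]
  set e := trivializationAt (EuclideanSpace ℝ (Fin n)) (TangentSpace (𝓡 n) : M → Type _) x with he
  have h1 : ContMDiffOn (𝓡 n) 𝓘(ℝ, EuclideanSpace ℝ (Fin n)) ∞ (fun z => (e ⟨z, X z⟩).2)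
      (W ∩ (chartAt (EuclideanSpace ℝ (Fin n)) x).source) := by
    intro z hz
    exact ((e.contMDiffWithinAt_section _ hz.2).1 (hX z hz.1)).mono inter_subset_left
  have h2 : ContMDiffOn 𝓘(ℝ, EuclideanSpace ℝ (Fin n)) 𝓘(ℝ, EuclideanSpace ℝ (Fin n)) ∞
      ((fun z => (e ⟨z, X z⟩).2) ∘ (extChartAt (𝓡 n) x).symm)
      ((extChartAt (𝓡 n) x).target ∩ (extChartAt (𝓡 n) x).symm ⁻¹' W) := by
    refine h1.comp ((contMDiffOn_extChartAt_symm x).mono inter_subset_left) fun y hy => ⟨hy.2, ?_⟩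
    have := (extChartAt (𝓡 n) x).map_target hy.1
    rwa [extChartAt_source] at this
  refine h2.congr fun y hy => ?_
  have hs : (extChartAt (𝓡 n) x).symm y ∈ (chartAt (EuclideanSpace ℝ (Fin n)) x).source := by
    have := (extChartAt (𝓡 n) x).map_target hy.1
    rwa [extChartAt_source] at this
  rw [coordField, chartDeriv, ← TangentBundle.continuousLinearMapAt_trivializationAt hs]
  rw [Bundle.Trivialization.continuousLinearMapAt_apply, Bundle.Trivialization.linearMapAt_apply]
  rw [if_pos (by exact hs)]
  rfl

/-- The manifold bracket is defined by pulling fields back along the inverse chart. These pullbacks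
have the germs of the coordinate fields, and a bracket depends only on germs. -/
lemma chartDeriv_mlieBracket (x : M) (X Y : ∀ z : M, TangentSpace (𝓡 n) z) :
    chartDeriv x x (mlieBracket (𝓡 n) X Y x) =
      lieBracket ℝ (coordField x X) (coordField x Y) (extChartAt (𝓡 n) x x) := by
  have hx : x ∈ (extChartAt (𝓡 n) x).source := mem_extChartAt_source x
  have hinv : (mfderiv (𝓡 n) 𝓘(ℝ, EuclideanSpace ℝ (Fin n)) (extChartAt (𝓡 n) x)
    x).IsInvertible := isInvertible_mfderiv_extChartAt hx
  have hfield : ∀ Z : ∀ z : M, TangentSpace (𝓡 n) z,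
      mpullbackWithin 𝓘(ℝ, EuclideanSpace ℝ (Fin n)) (𝓡 n) (extChartAt (𝓡 n) x).symm Z
        (range (𝓡 n)) =ᶠ[𝓝 (extChartAt (𝓡 n) x x)] coordField x Z := by
    intro Z
    filter_upwards [extChartAt_target_mem_nhds (I := 𝓡 n) x] with y hy
    have hi : (chartSymmDeriv x y).IsInvertible := by
      have := isInvertible_mfderivWithin_extChartAt_symm (I := 𝓡 n) hy
      rwa [ModelWithCorners.Boundaryless.range_eq_univ, mfderivWithin_univ] at this
    rw [mpullbackWithin_apply, ModelWithCorners.Boundaryless.range_eq_univ, mfderivWithin_univ]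
    obtain ⟨e, he⟩ := hi
    have h1 : (chartSymmDeriv x y).inverse (Z ((extChartAt (𝓡 n) x).symm y)) =
        coordField x Z y := by
      rw [← he, ContinuousLinearMap.inverse_equiv]
      refine (e.symm_apply_eq).2 ?_
      have := chartSymmDeriv_chartDeriv hy (Z ((extChartAt (𝓡 n) x).symm y))
      rw [← he] at this
      exact this.symm
    exact h1
  have hbr := (hfield X).lieBracket_vectorField_eq (𝕜 := ℝ) (hfield Y)
  rw [← hbr, ← mlieBracketWithin_univ, mlieBracketWithin_apply]
  simp only [preimage_univ, univ_inter]
  obtain ⟨e, he⟩ := hinv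
  rw [chartDeriv, ← he, ContinuousLinearMap.inverse_equiv]
  refine (ContinuousLinearEquiv.apply_symm_apply e _).trans ?_
  rw [ModelWithCorners.Boundaryless.range_eq_univ]
  exact congrFun (lieBracketWithin_univ (𝕜 := ℝ) (E := EuclideanSpace ℝ (Fin n))) _

end Coordinates

/-! ### Local comparison of quadratic forms -/

section QuadraticBounds

variable {Z F : Type*} [TopologicalSpace Z] [NormedAddCommGroup F] [NormedSpace ℝ F]
  [FiniteDimensional ℝ F]

/-- A continuous family of functions which are homogeneous of degree two is locally uniformly
comparable to the square of the norm if it is positive definite at a point. -/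
lemma exists_sq_norm_bounds {q : Z → F → ℝ} {x : Z}
    (hq : ∀ c, ContinuousAt (fun p : Z × F => q p.1 p.2) (x, c))
    (hsmul : ∀ z (a : ℝ) c, q z (a • c) = a ^ 2 * q z c) (hpos : ∀ c, c ≠ 0 → 0 < q x c) :
    ∃ m > 0, ∃ B > 0, ∀ᶠ z in 𝓝 x, ∀ c, m * ‖c‖ ^ 2 ≤ q z c ∧ q z c ≤ B * ‖c‖ ^ 2 := by
  have : ProperSpace F := FiniteDimensional.proper ℝ F
  have hcomp := isCompact_sphere (0 : F) 1
  have hcont : ContinuousOn (q x) (Metric.sphere 0 1) := fun c _ =>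
    ((hq c).comp (f := fun c : F => (x, c)) (by fun_prop)).continuousWithinAt
  obtain ⟨m, hm, hmq⟩ := hcomp.exists_forall_le' hcont (a := 0) fun c hc =>
    hpos c (Metric.ne_of_mem_sphere hc one_ne_zero)
  obtain ⟨B, hB⟩ := hcomp.exists_bound_of_continuousOn hcont
  -- Compactness of the unit sphere makes the neighbourhood of `x` independent of `c`; homogeneity
  -- then extends the bounds to all vectors.
  have hev : ∀ᶠ z in 𝓝 x, ∀ c ∈ Metric.sphere (0 : F) 1,
      m / 2 < q z c ∧ q z c < max B 0 + 1 := by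
    refine hcomp.eventually_forall_of_forall_eventually fun c hc => ?_
    refine (hq c).eventually (Ioo_mem_nhds ?_ ?_)
    · have := hmq c hc
      simp only; linarith
    · have := (le_abs_self _).trans (hB c hc)
      have := le_max_left B 0
      simp only; linarith
  refine ⟨m / 2, by positivity, max B 0 + 1, by positivity, ?_⟩
  filter_upwards [hev] with z hz c
  rcases eq_or_ne c 0 with rfl | hc
  · have := hsmul z 0 0
    rw [smul_zero] at this
    rw [this]; simp
  · have hc' : 0 < ‖c‖ := norm_pos_iff.2 hc
    obtain ⟨h1, h2⟩ := hz (‖c‖⁻¹ • c) (by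
      rw [mem_sphere_zero_iff_norm, norm_smul, norm_inv, norm_norm, inv_mul_cancel₀ hc'.ne'])
    have h3 : q z c = ‖c‖ ^ 2 * q z (‖c‖⁻¹ • c) := by
      rw [← hsmul, smul_smul, mul_inv_cancel₀ hc'.ne', one_smul]
    have h4 : 0 < ‖c‖ ^ 2 := by positivity
    rw [h3]
    constructor <;> nlinarith

end QuadraticBounds

/-! ### Frames and comparison of metrics with the chart norm -/

namespace PlaneDistribution

variable {n p : ℕ} {M : Type*} [TopologicalSpace M]
  [ChartedSpace (EuclideanSpace ℝ (Fin n)) M] [IsManifold (𝓡 n) ∞ M]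

/-- The linear map spanned in a chart by vector fields. -/
noncomputable def frameMap (x : M) (s : Fin p → ∀ z : M, TangentSpace (𝓡 n) z)
    (y : EuclideanSpace ℝ (Fin n)) : (Fin p → ℝ) →L[ℝ] EuclideanSpace ℝ (Fin n) :=
  ∑ i, (ContinuousLinearMap.proj (R := ℝ) (φ := fun _ : Fin p => ℝ) i).smulRight
    (coordField x (s i) y)

omit [IsManifold (𝓡 n) ∞ M] in
lemma frameMap_apply (x : M) (s : Fin p → ∀ z : M, TangentSpace (𝓡 n) z)
    (y : EuclideanSpace ℝ (Fin n)) (c : Fin p → ℝ) :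
    frameMap x s y c = chartDeriv x ((extChartAt (𝓡 n) x).symm y)
      (∑ i, c i • s i ((extChartAt (𝓡 n) x).symm y)) := by
  rw [frameMap, sum_apply]
  refine Eq.trans ?_ (map_sum (chartDeriv x ((extChartAt (𝓡 n) x).symm y)) _ _).symm
  refine Finset.sum_congr rfl fun i _ => ?_
  rw [map_smul]
  rfl

lemma contDiffOn_frameMap {x : M} {s : Fin p → ∀ z : M, TangentSpace (𝓡 n) z} {W : Set M}
    (hs : ∀ i, ContMDiffOn (𝓡 n) (𝓡 n).tangent ∞
      (fun z => (⟨z, s i z⟩ : TangentBundle (𝓡 n) M)) W) :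
    ContDiffOn ℝ ∞ (frameMap x s)
      ((extChartAt (𝓡 n) x).target ∩ (extChartAt (𝓡 n) x).symm ⁻¹' W) := by
  unfold frameMap
  exact ContDiffOn.sum fun i _ => contDiffOn_const.smulRight (contDiffOn_coordField (hs i))

/-- A Riemannian metric on a distribution is locally uniformly equivalent to the Euclidean metric
of a chart. -/
lemma RiemannianMetricOn.exists_bounds {D : PlaneDistribution n p M} (g : D.RiemannianMetricOn)
    (x : M) : ∃ C > 0, ∀ᶠ z in 𝓝 x, ∀ v : D.fiber z,
      g.form z v v ≤ C * ‖chartDeriv x z (v : TangentSpace (𝓡 n) z)‖ ^ 2 ∧ ‖chartDeriv x z (v : TangentSpace (𝓡 n) z)‖ ^ 2 ≤ C * g.form z v v := by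
  classical
  obtain ⟨W, hW, hxW, s, hs, hsD⟩ := D.exists_frame x
  have hmem : ∀ z ∈ W, ∀ i, s i z ∈ D.fiber z := fun z hz i =>
    (hsD z hz).2 ▸ Submodule.subset_span ⟨i, rfl⟩
  -- The smoothness axiom of the metric takes sections defined on all of `M`, so the frame is
  -- extended by zero outside `W`.
  set σ : Fin p → ∀ z : M, D.fiber z := fun i z =>
    if h : z ∈ W then ⟨s i z, hmem z h i⟩ else 0 with hσ
  have hσs : ∀ z ∈ W, ∀ i, (σ i z : TangentSpace (𝓡 n) z) = s i z := fun z hz i => by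
    simp [hσ, hz]
  have hσsm : ∀ i, ContMDiffOn (𝓡 n) (𝓡 n).tangent ∞
      (fun z => (⟨z, (σ i z : TangentSpace (𝓡 n) z)⟩ : TangentBundle (𝓡 n) M)) W := fun i =>
    (hs i).congr fun z hz => by rw [hσs z hz i]
  have hWx : W ∈ 𝓝 x := hW.mem_nhds hxW
  have hG : ∀ i j, ContinuousAt (fun z => g.form z (σ i z) (σ j z)) x := fun i j =>
    (g.smooth W (σ i) (σ j) hW (hσsm i) (hσsm j)).continuousOn.continuousAt hWx
  have hxs := mem_extChartAt_source (I := 𝓡 n) x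
  have hS : ContinuousAt (fun z => frameMap x s (extChartAt (𝓡 n) x z)) x := by
    have h1 : ContinuousAt (frameMap x s) (extChartAt (𝓡 n) x x) := by
      refine ((contDiffOn_frameMap hs).continuousOn).continuousAt ?_
      refine Filter.inter_mem (extChartAt_target_mem_nhds x) ?_
      refine (continuousAt_extChartAt_symm x).preimage_mem_nhds ?_
      rwa [extChartAt_to_inv]
    exact h1.comp (continuousAt_extChartAt x)
  have hli : ∀ z ∈ W, ∀ c : Fin p → ℝ, ∑ i, c i • s i z = 0 → c = 0 := fun z hz c hc =>
    funext (Fintype.linearIndependent_iff.1 (hsD z hz).1 c hc)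
  have hexp : ∀ z (c : Fin p → ℝ), g.form z (∑ i, c i • σ i z) (∑ i, c i • σ i z) =
      ∑ i, ∑ j, c i * c j * g.form z (σ i z) (σ j z) := by
    intro z c
    simp only [map_sum, LinearMap.sum_apply, map_smul, LinearMap.smul_apply, smul_eq_mul, Finset.mul_sum]
    rw [Finset.sum_comm]
    exact Finset.sum_congr rfl fun i _ => Finset.sum_congr rfl fun j _ => by ring
  -- Both the metric and the squared chart norm are positive definite in the frame coefficients `c`;
  -- each is compared with `‖c‖ ^ 2`.
  obtain ⟨m₁, hm₁, B₁, hB₁, h₁⟩ := exists_sq_norm_bounds (x := x)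
    (q := fun z (c : Fin p → ℝ) => ∑ i, ∑ j, c i * c j * g.form z (σ i z) (σ j z))
    (fun c => by
      refine tendsto_finsetSum _ fun i _ => tendsto_finsetSum _ fun j _ => ?_
      have h1 : ContinuousAt (fun p : M × (Fin p → ℝ) => p.2 i * p.2 j) (x, c) := by fun_prop
      exact h1.mul (ContinuousAt.comp (x := (x, c)) (f := Prod.fst)
        (g := fun z => g.form z (σ i z) (σ j z)) (hG i j) continuousAt_fst))
    (fun z a c => by
      simp only [Finset.mul_sum, Pi.smul_apply, smul_eq_mul]
      exact Finset.sum_congr rfl fun i _ => Finset.sum_congr rfl fun j _ => by ring)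
    (fun c hc => by
      rw [← hexp]
      refine g.pos x _ fun h => hc (hli x hxW c ?_)
      have h2 := congrArg (Subtype.val) h
      simpa [hσs x hxW] using h2)
  obtain ⟨m₂, hm₂, B₂, hB₂, h₂⟩ := exists_sq_norm_bounds (x := x)
    (q := fun z (c : Fin p → ℝ) => ‖frameMap x s (extChartAt (𝓡 n) x z) c‖ ^ 2)
    (fun c => by
      refine ContinuousAt.pow (ContinuousAt.norm ?_) 2
      exact (ContinuousAt.comp (x := (x, c)) hS continuousAt_fst).clm_apply continuousAt_snd)
    (fun z a c => by rw [map_smul, norm_smul, mul_pow, Real.norm_eq_abs, sq_abs])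
    (fun c hc => by
      have : frameMap x s (extChartAt (𝓡 n) x x) c ≠ 0 := by
        rw [frameMap_apply, extChartAt_to_inv]
        intro h
        refine hc (hli x hxW c ((chartDeriv_bijective hxs).1 ?_))
        rw [h, map_zero]
      positivity)
  refine ⟨max (B₁ / m₂) (B₂ / m₁), by positivity, ?_⟩
  filter_upwards [h₁, h₂, hWx, extChartAt_source_mem_nhds (I := 𝓡 n) x] with z hz₁ hz₂ hzW hzs v
  obtain ⟨c, hc⟩ : ∃ c : Fin p → ℝ, ∑ i, c i • s i z = v := by
    have : (v : TangentSpace (𝓡 n) z) ∈ Submodule.span ℝ (range fun i => s i z) :=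
      (hsD z hzW).2.symm ▸ v.2
    exact (Submodule.mem_span_range_iff_exists_fun ℝ).1 this
  have hv : v = ∑ i, c i • σ i z := by
    refine Subtype.ext ?_
    simp [hσs z hzW, hc]
  have e1 : g.form z v v = ∑ i, ∑ j, c i * c j * g.form z (σ i z) (σ j z) := by
    rw [hv, hexp]
  have e2 : chartDeriv x z (v : TangentSpace (𝓡 n) z) = frameMap x s (extChartAt (𝓡 n) x z) c := by
    rw [frameMap_apply, (extChartAt (𝓡 n) x).left_inv hzs, hc]
  have f1 := hz₁ c
  have f2 := hz₂ c
  rw [← e1] at f1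
  rw [← e2] at f2
  have g0 : 0 ≤ ‖c‖ ^ 2 := by positivity
  constructor
  · calc g.form z v v ≤ B₁ * ‖c‖ ^ 2 := f1.2
      _ = B₁ / m₂ * (m₂ * ‖c‖ ^ 2) := by field_simp
      _ ≤ max (B₁ / m₂) (B₂ / m₁) * ‖chartDeriv x z (v : TangentSpace (𝓡 n) z)‖ ^ 2 :=
        mul_le_mul (le_max_left _ _) f2.1 (by positivity) (by positivity)
  · calc ‖chartDeriv x z (v : TangentSpace (𝓡 n) z)‖ ^ 2 ≤ B₂ * ‖c‖ ^ 2 := f2.2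
      _ = B₂ / m₁ * (m₁ * ‖c‖ ^ 2) := by field_simp
      _ ≤ max (B₁ / m₂) (B₂ / m₁) * g.form z v v :=
        mul_le_mul (le_max_right _ _) f1.1 (by positivity) (by positivity)

end PlaneDistribution

/-! ### Projections onto a distribution along a fixed subspace -/

section ProjectionField

/-- Near a point where a smooth family of subspaces, given as the ranges of `S y`, is complementary
to `V₀`, the projections onto these subspaces along `V₀` form a smooth field. -/
lemma exists_projection_field {E F : Type*} [NormedAddCommGroup E] [NormedSpace ℝ E]
    [FiniteDimensional ℝ E] [NormedAddCommGroup F] [NormedSpace ℝ F] [FiniteDimensional ℝ F]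
    {S : E → F →L[ℝ] E} {O : Set E} (hO : IsOpen O) {x : E} (hx : x ∈ O)
    (hS : ContDiffOn ℝ 1 S O) {V₀ : Submodule ℝ E} (hinj : Function.Injective (S x))
    (hcompl : IsCompl (LinearMap.range (S x : F →ₗ[ℝ] E)) V₀) :
    ∃ (L : E → E →L[ℝ] E) (O' : Set E) (C : ℝ), IsOpen O' ∧ x ∈ O' ∧ O' ⊆ O ∧
      ContDiffOn ℝ 1 L O' ∧ ∀ y ∈ O', ‖L y‖ ≤ C ∧ (∀ v ∈ V₀, L y v = 0) ∧
        (∀ v, v - L y v ∈ V₀) ∧ (∀ c, L y (S y c) = S y c) ∧ ∀ v, ∃ c, S y c = L y v := by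
  have : CompleteSpace V₀ := FiniteDimensional.complete ℝ V₀
  have : CompleteSpace F := FiniteDimensional.complete ℝ F
  -- Complementarity makes `T x` invertible, and invertibility is an open condition. The projection
  -- is the first component of the inverse followed by `S y`.
  set T : E → F × V₀ →L[ℝ] E := fun y => (S y).comp (ContinuousLinearMap.fst ℝ F V₀) +
    V₀.subtypeL.comp (ContinuousLinearMap.snd ℝ F V₀) with hT
  have hTapp : ∀ y c (w : V₀), T y (c, w) = S y c + w := fun y c w => rfl
  have hTs : ContDiffOn ℝ 1 T O := (hS.clm_comp contDiffOn_const).add contDiffOn_const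
  have hbij : Function.Bijective (T x : F × V₀ →ₗ[ℝ] E) := by
    constructor
    · rw [injective_iff_map_eq_zero]
      rintro ⟨c, w⟩ h
      have h' : S x c + w = 0 := h
      have h1 : S x c = 0 := by
        refine (Submodule.disjoint_def.1 hcompl.disjoint) _ ⟨c, rfl⟩ ?_
        rw [eq_neg_of_add_eq_zero_left h']
        exact V₀.neg_mem w.2
      have h2 : c = 0 := hinj (h1.trans (map_zero _).symm)
      rw [h1, zero_add] at h'
      exact Prod.ext h2 (Subtype.ext h')
    · intro v
      have : v ∈ LinearMap.range (S x : F →ₗ[ℝ] E) ⊔ V₀ := hcompl.sup_eq_top ▸ Submodule.mem_top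
      obtain ⟨_, ⟨c, rfl⟩, w, hw, hcw⟩ := Submodule.mem_sup.1 this
      exact ⟨(c, ⟨w, hw⟩), hcw⟩
  set e₀ : (F × V₀) ≃L[ℝ] E := (LinearEquiv.ofBijective _ hbij).toContinuousLinearEquiv with he₀
  have he₀T : (e₀ : F × V₀ →L[ℝ] E) = T x := by ext v <;> rfl
  have hOx := hO.mem_nhds hx
  have hinvx : ∀ᶠ y in 𝓝 x, (T y).IsInvertible := by
    refine (hTs.continuousOn.continuousAt hOx).eventually ?_
    rw [← he₀T]
    exact ContinuousLinearEquiv.nhds e₀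
  set L : E → E →L[ℝ] E := fun y =>
    (S y).comp ((ContinuousLinearMap.fst ℝ F V₀).comp (T y).inverse) with hL
  have hLs : ∀ y ∈ O, (T y).IsInvertible → ContDiffAt ℝ 1 L y := by
    rintro y hy ⟨e, he⟩
    have h1 : ContDiffAt ℝ 1 ContinuousLinearMap.inverse (T y) := he ▸ contDiffAt_map_inverse e
    have h2 : ContDiffAt ℝ 1 (fun y => (T y).inverse) y :=
      h1.comp y (hTs.contDiffAt (hO.mem_nhds hy))
    exact (hS.contDiffAt (hO.mem_nhds hy)).clm_comp (contDiffAt_const.clm_comp h2)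
  have hbd : ∀ᶠ y in 𝓝 x, ‖L y‖ ≤ ‖L x‖ + 1 :=
    (hLs x hx hinvx.self_of_nhds).continuousAt.norm.eventually (Iic_mem_nhds (lt_add_one ‖L x‖))
  obtain ⟨O', hO', hO'o, hxO'⟩ := eventually_nhds_iff.1 (hinvx.and (hbd.and hOx))
  refine ⟨L, O', ‖L x‖ + 1, hO'o, hxO', fun y hy => (hO' y hy).2.2,
    fun y hy => (hLs y (hO' y hy).2.2 (hO' y hy).1).contDiffWithinAt, fun y hy => ?_⟩
  obtain ⟨e, he⟩ := (hO' y hy).1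
  have hLe : ∀ c (w : V₀), L y (S y c + w) = S y c := by
    intro c w
    have h1 : L y (S y c + w) = S y (((T y).inverse (T y (c, w))).1) := rfl
    rw [h1, ← he, ContinuousLinearMap.inverse_equiv]
    simp
  have hdec : ∀ v, ∃ c, ∃ w : V₀, S y c + w = v := by
    intro v
    refine ⟨(e.symm v).1, (e.symm v).2, ?_⟩
    rw [← hTapp, ← he]
    simp
  refine ⟨(hO' y hy).2.1, fun v hv => ?_, fun v => ?_, fun c => ?_, fun v => ?_⟩
  · simpa using hLe 0 ⟨v, hv⟩
  · obtain ⟨c, w, rfl⟩ := hdec v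
    rw [hLe, add_sub_cancel_left]
    exact w.2
  · simpa using hLe c 0
  · obtain ⟨c, w, rfl⟩ := hdec v
    exact ⟨c, (hLe c w).symm⟩

end ProjectionField

/-! ### Tangent spaces of a foliation in a chart -/

namespace Foliation

variable {n p : ℕ} {M : Type*} [TopologicalSpace M]
  [ChartedSpace (EuclideanSpace ℝ (Fin n)) M] [IsManifold (𝓡 n) ∞ M] {U : Set M}

/-- The coordinates of a foliated chart, as a function of the coordinates of the preferred chart
at `x`. -/
noncomputable def coordChart (x : M) (φ : OpenPartialHomeomorph M
    (EuclideanSpace ℝ (Fin p) × EuclideanSpace ℝ (Fin (n - p)))) (y : EuclideanSpace ℝ (Fin n)) :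
    EuclideanSpace ℝ (Fin p) × EuclideanSpace ℝ (Fin (n - p)) :=
  φ ((extChartAt (𝓡 n) x).symm y)

/-- The transverse coordinates of a foliated chart, as a function of the coordinates of the
preferred chart at `x`. -/
noncomputable def transverse (x : M) (φ : OpenPartialHomeomorph M
    (EuclideanSpace ℝ (Fin p) × EuclideanSpace ℝ (Fin (n - p)))) (y : EuclideanSpace ℝ (Fin n)) :
    EuclideanSpace ℝ (Fin (n - p)) :=
  (coordChart x φ y).2

variable {F : Foliation n p U} {x : M}
  {φ ψ : OpenPartialHomeomorph M (EuclideanSpace ℝ (Fin p) × EuclideanSpace ℝ (Fin (n - p)))}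
  {y : EuclideanSpace ℝ (Fin n)}

lemma contDiffAt_coordChart (hφ : φ ∈ F.charts) (hy : y ∈ (extChartAt (𝓡 n) x).target)
    (hyφ : (extChartAt (𝓡 n) x).symm y ∈ φ.source) : ContDiffAt ℝ ∞ (coordChart x φ) y := by
  rw [← contMDiffAt_iff_contDiffAt]
  have h1 := (F.smooth φ hφ).contMDiffAt (φ.open_source.mem_nhds hyφ)
  have h2 := (contMDiffOn_extChartAt_symm (I := 𝓡 n) (n := ∞) x).contMDiffAt
    ((isOpen_extChartAt_target x).mem_nhds hy)
  exact h1.comp y h2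

lemma contDiffAt_transverse (hφ : φ ∈ F.charts) (hy : y ∈ (extChartAt (𝓡 n) x).target)
    (hyφ : (extChartAt (𝓡 n) x).symm y ∈ φ.source) : ContDiffAt ℝ ∞ (transverse x φ) y :=
  (contDiffAt_coordChart hφ hy hyφ).snd

lemma fderiv_transverse_apply (hφ : φ ∈ F.charts) (hy : y ∈ (extChartAt (𝓡 n) x).target)
    (hyφ : (extChartAt (𝓡 n) x).symm y ∈ φ.source) (u : EuclideanSpace ℝ (Fin n)) :
    fderiv ℝ (transverse x φ) y u = (fderiv ℝ (coordChart x φ) y u).2 := by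
  have h := ((contDiffAt_coordChart hφ hy hyφ).differentiableAt (by simp)).hasFDerivAt.snd
  exact congrArg (fun A : EuclideanSpace ℝ (Fin n) →L[ℝ] EuclideanSpace ℝ (Fin (n - p)) => A u)
    h.fderiv

lemma isTangent_chartSymmDeriv (hφ : φ ∈ F.charts) (hy : y ∈ (extChartAt (𝓡 n) x).target)
    (hyφ : (extChartAt (𝓡 n) x).symm y ∈ φ.source) {u : EuclideanSpace ℝ (Fin n)}
    (hu : fderiv ℝ (transverse x φ) y u = 0) :
    F.IsTangent ((extChartAt (𝓡 n) x).symm y) (chartSymmDeriv x y u) := by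
  refine ⟨φ, hφ, hyφ, ?_⟩
  rw [fderiv_transverse_apply hφ hy hyφ] at hu
  have h1 := ((F.smooth φ hφ).contMDiffAt (φ.open_source.mem_nhds hyφ)).mdifferentiableAt
    (by simp)
  have h2 := ((contMDiffOn_extChartAt_symm (I := 𝓡 n) (n := ∞) x).contMDiffAt
    ((isOpen_extChartAt_target x).mem_nhds hy)).mdifferentiableAt (by simp)
  have h3 := mfderiv_comp y h1 h2
  rw [mfderiv_eq_fderiv] at h3
  have h4 := congrArg (fun A : EuclideanSpace ℝ (Fin n) →L[ℝ]
    EuclideanSpace ℝ (Fin p) × EuclideanSpace ℝ (Fin (n - p)) => (A u).2) h3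
  exact h4.symm.trans hu

/-- Compatibility speaks of plaques only, so it is differentiated along a curve with velocity `u`
inside a plaque of `φ`: a straight line in the `φ`-coordinates. The transverse coordinates of `ψ`
are constant along it. -/
lemma fderiv_transverse_eq_zero (hφ : φ ∈ F.charts) (hψ : ψ ∈ F.charts)
    (hy : y ∈ (extChartAt (𝓡 n) x).target)
    (hyφ : (extChartAt (𝓡 n) x).symm y ∈ φ.source)
    (hyψ : (extChartAt (𝓡 n) x).symm y ∈ ψ.source) {u : EuclideanSpace ℝ (Fin n)}
    (hu : fderiv ℝ (transverse x φ) y u = 0) : fderiv ℝ (transverse x ψ) y u = 0 := by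
  rw [fderiv_transverse_apply hφ hy hyφ] at hu
  set c := extChartAt (𝓡 n) x with hc
  set z := c.symm y with hz
  set G := coordChart (p := p) x φ with hG
  have hGy : G y = φ z := rfl
  have hzc : z ∈ c.source := c.map_target hy
  have hGd := ((contDiffAt_coordChart hφ hy hyφ).differentiableAt (by simp)).hasFDerivAt
  set G' : EuclideanSpace ℝ (Fin p) × EuclideanSpace ℝ (Fin (n - p)) → EuclideanSpace ℝ (Fin n) :=
    fun w => c (φ.symm w) with hG'
  have hG'd : DifferentiableAt ℝ G' (G y) := by
    have h1 := (F.smooth_symm φ hφ).contMDiffAt (φ.open_target.mem_nhds (φ.map_source hyφ))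
    have h2 : ContMDiffAt (𝓡 n) 𝓘(ℝ, EuclideanSpace ℝ (Fin n)) ∞ c (φ.symm (φ z)) := by
      rw [φ.left_inv hyφ]
      refine contMDiffAt_extChartAt' ?_
      rwa [hc, extChartAt_source] at hzc
    exact (contMDiffAt_iff_contDiffAt.1 (h2.comp (φ z) h1)).differentiableAt (by simp)
  have hcs : ContinuousAt c.symm y := continuousAt_extChartAt_symm'' hy
  have hGG : G' ∘ G =ᶠ[𝓝 y] id := by
    filter_upwards [hcs.preimage_mem_nhds (φ.open_source.mem_nhds hyφ),
      (isOpen_extChartAt_target x).mem_nhds hy] with y' h1 h2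
    have h3 : φ.symm (φ (c.symm y')) = c.symm y' := φ.left_inv h1
    change c (φ.symm (φ (c.symm y'))) = y'
    rw [h3, c.right_inv h2]
  have hcomp : fderiv ℝ G' (G y) (fderiv ℝ G y u) = u := by
    have h1 := (hG'd.hasFDerivAt.comp y hGd).congr_of_eventuallyEq hGG.symm
    exact congrArg (fun A : EuclideanSpace ℝ (Fin n) →L[ℝ] EuclideanSpace ℝ (Fin n) => A u)
      (h1.unique (hasFDerivAt_id y))
  set γ₀ : ℝ → EuclideanSpace ℝ (Fin p) × EuclideanSpace ℝ (Fin (n - p)) :=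
    fun t => G y + t • fderiv ℝ G y u with hγ₀
  have hγ₀0 : γ₀ 0 = G y := by simp [hγ₀]
  have hγ₀d : HasDerivAt γ₀ (fderiv ℝ G y u) 0 := by
    have h := ((hasDerivAt_id (0 : ℝ)).smul_const (fderiv ℝ G y u)).const_add (G y)
    rwa [one_smul] at h
  have hγd : HasDerivAt (fun t => G' (γ₀ t)) u 0 := by
    have h1 : HasFDerivAt G' (fderiv ℝ G' (G y)) (γ₀ 0) := hγ₀0 ▸ hG'd.hasFDerivAt
    have h2 := h1.comp_hasDerivAt (0 : ℝ) hγ₀d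
    rwa [hcomp] at h2
  have hG'y : G' (γ₀ 0) = y := by
    rw [hγ₀0, hGy, hG']
    simp only
    rw [φ.left_inv hyφ, hz, c.right_inv hy]
  obtain ⟨W, hW, hWs, hWc⟩ := F.compatible φ hφ ψ hψ z ⟨hyφ, hyψ⟩
  have hsymm : Filter.Tendsto (fun t => φ.symm (γ₀ t)) (𝓝 0) (𝓝 z) := by
    have h1 : ContinuousAt φ.symm (γ₀ 0) := by
      rw [hγ₀0, hGy]
      exact φ.continuousAt_symm (φ.map_source hyφ)
    have h2 := ContinuousAt.comp (f := γ₀) h1 hγ₀d.continuousAt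
    have h3 : φ.symm (γ₀ 0) = z := by rw [hγ₀0, hGy, φ.left_inv hyφ]
    rw [← h3]
    exact h2
  have hconst : (fun t => transverse x ψ (G' (γ₀ t))) =ᶠ[𝓝 0] fun _ => transverse x ψ y := by
    have ht : ∀ᶠ t in 𝓝 (0 : ℝ), γ₀ t ∈ φ.target := by
      refine hγ₀d.continuousAt.eventually (φ.open_target.mem_nhds ?_)
      rw [hγ₀0]
      exact φ.map_source hyφ
    have hcn : c.source ∈ 𝓝 z := extChartAt_source_mem_nhds' hzc
    filter_upwards [ht, hsymm.eventually hW, hsymm.eventually hcn] with t h1 h2 h3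
    have h4 : c.symm (G' (γ₀ t)) = φ.symm (γ₀ t) := c.left_inv h3
    have h5 : transverse x ψ (G' (γ₀ t)) = (ψ (φ.symm (γ₀ t))).2 := by
      rw [← h4]; rfl
    rw [h5]
    refine hWc _ h2 _ (mem_of_mem_nhds hW) ?_
    rw [φ.right_inv h1, hγ₀]
    simp only [Prod.snd_add, Prod.smul_snd, hu, smul_zero, add_zero]
    rfl
  have hψd : HasFDerivAt (transverse x ψ) (fderiv ℝ (transverse x ψ) y) (G' (γ₀ 0)) := by
    rw [hG'y]
    exact ((contDiffAt_transverse hψ hy hyψ).differentiableAt (by simp)).hasFDerivAt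
  have h1 := hψd.comp_hasDerivAt (0 : ℝ) hγd
  exact h1.unique ((hasDerivAt_const (0 : ℝ) (transverse x ψ y)).congr_of_eventuallyEq hconst)

variable (F x) in
open Classical in
/-- The tangent spaces of a foliation in the preferred chart at `x`. -/
noncomputable def coordTangent (y : EuclideanSpace ℝ (Fin n)) :
    Submodule ℝ (EuclideanSpace ℝ (Fin n)) :=
  if h : (extChartAt (𝓡 n) x).symm y ∈ U then
    LinearMap.ker (fderiv ℝ (transverse x (F.cover _ h).choose) y :
      EuclideanSpace ℝ (Fin n) →ₗ[ℝ] EuclideanSpace ℝ (Fin (n - p)))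
  else ⊥

/-- The chart picked by choice in `coordTangent` is irrelevant, and may vary from point to point. -/
lemma mem_coordTangent_iff (hφ : φ ∈ F.charts) (hy : y ∈ (extChartAt (𝓡 n) x).target)
    (hyφ : (extChartAt (𝓡 n) x).symm y ∈ φ.source) {u : EuclideanSpace ℝ (Fin n)} :
    u ∈ F.coordTangent x y ↔ fderiv ℝ (transverse x φ) y u = 0 := by
  have hU := F.source_subset φ hφ hyφ
  obtain ⟨h1, h2⟩ := (F.cover _ hU).choose_spec
  rw [coordTangent, dif_pos hU]
  exact ⟨fderiv_transverse_eq_zero h1 hφ hy h2 hyφ, fderiv_transverse_eq_zero hφ h1 hy hyφ h2⟩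

lemma isTangent_of_mem_coordTangent (hy : y ∈ (extChartAt (𝓡 n) x).target)
    (hyU : (extChartAt (𝓡 n) x).symm y ∈ U) {u : EuclideanSpace ℝ (Fin n)}
    (hu : u ∈ F.coordTangent x y) :
    F.IsTangent ((extChartAt (𝓡 n) x).symm y) (chartSymmDeriv x y u) := by
  obtain ⟨φ, hφ, hyφ⟩ := F.cover _ hyU
  exact isTangent_chartSymmDeriv hφ hy hyφ ((mem_coordTangent_iff hφ hy hyφ).1 hu)

/-- This is the form of integrability that `exists_norm_sub_gt_of_integrable` requires. -/
lemma exists_coordTangent_eq_ker (F : Foliation n p U) (hy : y ∈ (extChartAt (𝓡 n) x).target)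
    (hyU : (extChartAt (𝓡 n) x).symm y ∈ U) :
    ∃ ψ : EuclideanSpace ℝ (Fin n) → EuclideanSpace ℝ (Fin (n - p)), ContDiffAt ℝ ∞ ψ y ∧
      ∀ᶠ z in 𝓝 y, ∀ v, v ∈ F.coordTangent x z ↔ fderiv ℝ ψ z v = 0 := by
  obtain ⟨φ, hφ, hyφ⟩ := F.cover _ hyU
  refine ⟨transverse x φ, contDiffAt_transverse hφ hy hyφ, ?_⟩
  filter_upwards [(continuousAt_extChartAt_symm'' hy).preimage_mem_nhds
    (φ.open_source.mem_nhds hyφ), (isOpen_extChartAt_target x).mem_nhds hy] with z h1 h2 v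
  exact mem_coordTangent_iff hφ h2 h1

end Foliation

/-! ### Foliations near a twisting point, and the main theorem -/

open VectorField in
/-- In the chart at a twisting point `x`, subspaces which are close to `H` relative to a
complementary distribution `V` cannot be tangent to a foliation. -/
lemma PlaneDistribution.TwistedAt.exists_norm_gt {n p q : ℕ} {M : Type*} [TopologicalSpace M]
    [ChartedSpace (EuclideanSpace ℝ (Fin n)) M] [IsManifold (𝓡 n) ∞ M]
    {V : PlaneDistribution n q M} {H : PlaneDistribution n p M} (hVH : V.Complementary H)
    {x : M} (hx : H.TwistedAt x) {N : Set M} (hN : N ∈ 𝓝 x) :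
    ∃ ε > 0, ∀ (U : Set M) (F : Foliation n p U), N ⊆ U →
      ∃ z ∈ N, ∃ v : TangentSpace (𝓡 n) z, F.IsTangent z v ∧
        ∀ vV ∈ V.fiber z, ∀ vH ∈ H.fiber z, v = vV + vH →
          ε * ‖chartDeriv x z v‖ < ‖chartDeriv x z vV‖ := by
  obtain ⟨X, Y, ⟨WX, hWX, hxWX, hX, hXH⟩, ⟨WY, hWY, hxWY, hY, hYH⟩, hXY⟩ := hx
  obtain ⟨W, hW, hxW, s, hs, hsH⟩ := H.exists_frame x
  obtain ⟨N', hN'N, hN', hxN'⟩ := mem_nhds_iff.1 hN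
  set c := extChartAt (𝓡 n) x with hc
  have hxs : x ∈ c.source := mem_extChartAt_source x
  have hcx : c.symm (c x) = x := c.left_inv hxs
  have hopen : ∀ {A : Set M}, IsOpen A → IsOpen (c.target ∩ c.symm ⁻¹' A) := fun hA =>
    (continuousOn_extChartAt_symm x).isOpen_inter_preimage (isOpen_extChartAt_target x) hA
  have hmemx : ∀ {A : Set M}, x ∈ A → c x ∈ c.target ∩ c.symm ⁻¹' A := fun hA =>
    ⟨c.map_source hxs, by rw [mem_preimage, hcx]; exact hA⟩
  have hrange : ∀ y ∈ c.target ∩ c.symm ⁻¹' W, ∀ v ∈ H.fiber (c.symm y),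
      ∃ a, PlaneDistribution.frameMap x s y a = chartDeriv x (c.symm y) v := by
    intro y hy v hv
    rw [← (hsH _ hy.2).2] at hv
    obtain ⟨a, ha⟩ := (Submodule.mem_span_range_iff_exists_fun ℝ).1 hv
    exact ⟨a, by rw [PlaneDistribution.frameMap_apply]; exact congrArg _ ha⟩
  have hrange' : ∀ y ∈ c.target ∩ c.symm ⁻¹' W, ∀ a, ∃ v ∈ H.fiber (c.symm y),
      PlaneDistribution.frameMap x s y a = chartDeriv x (c.symm y) v := by
    intro y hy a
    refine ⟨_, ?_, PlaneDistribution.frameMap_apply x s y a⟩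
    rw [← (hsH _ hy.2).2]
    exact (Submodule.mem_span_range_iff_exists_fun ℝ).2 ⟨a, rfl⟩
  set Θ : TangentSpace (𝓡 n) (c.symm (c x)) ≃ₗ[ℝ] EuclideanSpace ℝ (Fin n) :=
    LinearEquiv.ofBijective (chartDeriv x (c.symm (c x))).toLinearMap
      (by exact chartDeriv_bijective (c.map_target (c.map_source hxs))) with hΘ
  -- The fibre of `V` at `x` alone is used, since the commutation argument needs a constant
  -- complement.
  set V₀ : Submodule ℝ (EuclideanSpace ℝ (Fin n)) :=
    (V.fiber (c.symm (c x))).map (Θ : _ →ₗ[ℝ] EuclideanSpace ℝ (Fin n)) with hV₀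
  have hSr : LinearMap.range (PlaneDistribution.frameMap x s (c x) :
      (Fin p → ℝ) →ₗ[ℝ] EuclideanSpace ℝ (Fin n)) =
      (H.fiber (c.symm (c x))).map (Θ : _ →ₗ[ℝ] EuclideanSpace ℝ (Fin n)) := by
    ext v
    constructor
    · rintro ⟨a, rfl⟩
      obtain ⟨w, hw, hw'⟩ := hrange' _ (hmemx hxW) a
      exact ⟨w, hw, hw'.symm⟩
    · rintro ⟨w, hw, rfl⟩
      exact hrange _ (hmemx hxW) w hw
  have hcompl : IsCompl (LinearMap.range (PlaneDistribution.frameMap x s (c x) :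
      (Fin p → ℝ) →ₗ[ℝ] EuclideanSpace ℝ (Fin n))) V₀ := by
    rw [hSr, hV₀]
    exact ((Submodule.orderIsoMapComap Θ).isCompl (hVH _)).symm
  have hinj : Function.Injective (PlaneDistribution.frameMap x s (c x)) := by
    rw [injective_iff_map_eq_zero]
    intro a ha
    rw [PlaneDistribution.frameMap_apply] at ha
    have h1 : ∑ i, a i • s i (c.symm (c x)) = 0 :=
      Θ.injective (ha.trans (map_zero Θ).symm)
    exact funext (Fintype.linearIndependent_iff.1 (hsH _ (hmemx hxW).2).1 a h1)
  have hdim : Module.finrank ℝ V₀ = Module.finrank ℝ (EuclideanSpace ℝ (Fin (n - p))) := by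
    have h1 := Submodule.finrank_add_eq_of_isCompl hcompl
    rw [LinearMap.finrank_range_of_inj hinj] at h1
    simp only [finrank_euclideanSpace, Fintype.card_fin, Module.finrank_fin_fun] at h1 ⊢
    omega
  obtain ⟨L, O, C, hO, hxO, hOsub, hL, hLprop⟩ := exists_projection_field
    (hopen (hW.inter hN')) (hmemx ⟨hxW, hxN'⟩)
    ((PlaneDistribution.contDiffOn_frameMap hs).of_le (by simp) |>.mono fun y hy =>
      ⟨hy.1, hy.2.1⟩) hinj hcompl
  have hOt : ∀ y ∈ O, y ∈ c.target := fun y hy => (hOsub hy).1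
  have hOW : ∀ y ∈ O, y ∈ c.target ∩ c.symm ⁻¹' W := fun y hy =>
    ⟨(hOsub hy).1, (hOsub hy).2.1⟩
  have hON : ∀ y ∈ O, c.symm y ∈ N := fun y hy => hN'N (hOsub hy).2.2
  have hLH : ∀ y ∈ O, ∀ v ∈ H.fiber (c.symm y),
      L y (chartDeriv x (c.symm y) v) = chartDeriv x (c.symm y) v := by
    intro y hy v hv
    obtain ⟨a, ha⟩ := hrange y (hOW y hy) v hv
    rw [← ha]
    exact (hLprop y hy).2.2.2.1 a
  have hsec : ∀ {Z : ∀ z : M, TangentSpace (𝓡 n) z} {A : Set M}, IsOpen A → x ∈ A →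
      ContMDiffOn (𝓡 n) (𝓡 n).tangent ∞ (fun z => (⟨z, Z z⟩ : TangentBundle (𝓡 n) M)) A →
      (∀ z ∈ A, Z z ∈ H.fiber z) → DifferentiableAt ℝ (coordField x Z) (c x) ∧
      ∀ᶠ y in 𝓝 (c x), L y (coordField x Z y) = coordField x Z y := by
    intro Z A hA hxA hZ hZH
    have hnhds := (hopen hA).mem_nhds (hmemx hxA)
    refine ⟨((contDiffOn_coordField hZ).differentiableOn (by simp)).differentiableAt hnhds, ?_⟩
    filter_upwards [hnhds, hO.mem_nhds hxO] with y hyA hyO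
    exact hLH y hyO _ (hZH _ hyA.2)
  obtain ⟨hXd, hLX⟩ := hsec hWX hxWX hX hXH
  obtain ⟨hYd, hLY⟩ := hsec hWY hxWY hY hYH
  have hbr : L (c x) (lieBracket ℝ (coordField x X) (coordField x Y) (c x)) ≠
      lieBracket ℝ (coordField x X) (coordField x Y) (c x) := by
    intro h
    obtain ⟨a, ha⟩ := (hLprop _ hxO).2.2.2.2
      (lieBracket ℝ (coordField x X) (coordField x Y) (c x))
    obtain ⟨w, hw, hw'⟩ := hrange' _ (hmemx hxW) a
    rw [h, hw', hcx, ← chartDeriv_mlieBracket] at ha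
    rw [hcx] at hw
    refine hXY ((Submodule.Quotient.mk_eq_zero _).2 ?_)
    rw [← (chartDeriv_bijective hxs).1 ha]
    exact hw
  obtain ⟨ε, hε, hmain⟩ := exists_norm_sub_gt_of_integrable hdim hO hxO hL
    (fun y hy => (hLprop y hy).2.1) (fun y hy => (hLprop y hy).2.2.1) hXd hYd hLX hLY hbr
  have hC : 0 ≤ C := (norm_nonneg _).trans (hLprop _ hxO).1
  refine ⟨ε / (1 + C), by positivity, fun U F hNU => ?_⟩
  obtain ⟨y, hy, u, hu, hlt⟩ := hmain (F.coordTangent x) fun y hy =>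
    F.exists_coordTangent_eq_ker (hOt y hy) (hNU (hON y hy))
  refine ⟨c.symm y, hON y hy, chartSymmDeriv x y u,
    Foliation.isTangent_of_mem_coordTangent (hOt y hy) (hNU (hON y hy)) hu, ?_⟩
  intro vV hvV vH hvH hv
  have h1 : u = chartDeriv x (c.symm y) vV + chartDeriv x (c.symm y) vH := by
    rw [← map_add, ← hv]
    exact (chartDeriv_chartSymmDeriv (hOt y hy) u).symm
  have h2 : chartDeriv x (c.symm y) (chartSymmDeriv x y u) = u :=
    chartDeriv_chartSymmDeriv (hOt y hy) u
  -- `L` fixes `H`, so only the component in the true fibre of `V` contributes. This passes from the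
  -- projection along `V₀` to the splitting `V ⊕ H` at the price of a factor `1 + C`.
  have h3 : u - L y u = chartDeriv x (c.symm y) vV - L y (chartDeriv x (c.symm y) vV) := by
    rw [h1, map_add, hLH y hy vH hvH]
    abel
  have h4 : ‖u - L y u‖ ≤ (1 + C) * ‖chartDeriv x (c.symm y) vV‖ := by
    rw [h3]
    refine (norm_sub_le _ _).trans ?_
    have := (L y).le_of_opNorm_le (hLprop y hy).1 (chartDeriv x (c.symm y) vV)
    linarith
  rw [h2, div_mul_eq_mul_div, div_lt_iff₀ (by positivity)]
  linarith

theorem mainTheorem6 {n p q : ℕ} {M : Type*} [TopologicalSpace M]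
    [ChartedSpace (EuclideanSpace ℝ (Fin n)) M] [IsManifold (𝓡 n) ∞ M]
    (V : PlaneDistribution n q M) (H : PlaneDistribution n p M) (hVH : V.Complementary H)
    (x : M) (hx : H.TwistedAt x)
    (gV : V.RiemannianMetricOn) (gH : H.RiemannianMetricOn)
    (U : Set M) (hU : IsOpen U) (hxU : x ∈ U)
    (f : ℕ → M → ℝ) (hf_smooth : ∀ k : ℕ, ContMDiff (𝓡 n) 𝓘(ℝ, ℝ) ∞ (f k))
    (hf_pos : ∀ (k : ℕ) (y : M), 0 < f k y) (hf_ge : ∀ k : ℕ, ∀ y ∈ U, (k : ℝ) ≤ f k y) :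
    ∃ kU : ℕ, ∀ k : ℕ, kU ≤ k → ¬ ∃ F : Foliation n p U,
      ∀ (y : M) (v : TangentSpace (𝓡 n) y), F.IsTangent y v →
        ¬ IsTimelike
          (PlaneDistribution.sumForm hVH (fun z => (-((f k z) ^ 2)) • gV.form z) gH.form y) v := by
  obtain ⟨CV, hCV, hV⟩ := gV.exists_bounds x
  obtain ⟨CH, hCH, hH⟩ := gH.exists_bounds x
  have hN := (hV.and hH).and (hU.mem_nhds hxU)
  obtain ⟨ε, hε, hmain⟩ := hx.exists_norm_gt hVH hN
  -- `K ^ 2` dominates `CV * CH`, so non-timelikeness will read `k * a ≤ K * b` for the chart norms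
  -- `a`, `b` of the two components.
  set K := CV + CH with hK
  have hK0 : 0 < K := by positivity
  -- Since `b ≤ u + a`, the inequality `k * a ≤ K * b` gives `(k - K) * a ≤ K * u`. For `k - K ≥ K /
  -- ε` this yields `a ≤ ε * u`, contradicting `hlt'`.
  obtain ⟨k₀, hk₀⟩ := exists_nat_ge (K + K / ε)
  refine ⟨k₀, fun k hk => ?_⟩
  rintro ⟨F, hF⟩
  obtain ⟨z, ⟨⟨hzV, hzH⟩, hzU⟩, v, hv, hlt⟩ := hmain U F fun z hz => hz.2
  set vV := (V.fiber z).projectionOnto (H.fiber z) (hVH z) v with hvV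
  set vH := (H.fiber z).projectionOnto (V.fiber z) (hVH z).symm v with hvH
  have hsum : v = vV + vH := by
    rw [hvV, hvH]
    exact (Submodule.projection_add_projection_eq_self (hVH z) v).symm
  have hlt' := hlt vV vV.2 vH vH.2 hsum
  have hnt := hF z v hv
  have hge : f k z ^ 2 * gV.form z vV vV ≤ gH.form z vH vH := by
    have h1 : PlaneDistribution.sumForm hVH (fun z => (-((f k z) ^ 2)) • gV.form z) gH.form z v v =
        -((f k z) ^ 2) * gV.form z vV vV + gH.form z vH vH := rfl
    rw [IsTimelike, h1] at hnt
    linarith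
  set a := ‖chartDeriv x z (vV : TangentSpace (𝓡 n) z)‖ with ha
  set b := ‖chartDeriv x z (vH : TangentSpace (𝓡 n) z)‖ with hb
  set u := ‖chartDeriv x z v‖ with hu
  have ha0 : 0 ≤ a := norm_nonneg _
  have hb0 : 0 ≤ b := norm_nonneg _
  have hu0 : 0 ≤ u := norm_nonneg _
  have hbu : b ≤ u + a := by
    have : chartDeriv x z (vH : TangentSpace (𝓡 n) z) = chartDeriv x z v -
        chartDeriv x z (vV : TangentSpace (𝓡 n) z) := by
      rw [← map_sub]
      exact congrArg _ (eq_sub_of_add_eq' hsum.symm)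
    rw [hb, this]
    exact norm_sub_le _ _
  have hkf : (k : ℝ) ≤ f k z := hf_ge k z hzU
  have hkK : K + K / ε ≤ k := hk₀.trans (by exact_mod_cast hk)
  have hab : (k * a) ^ 2 ≤ (K * b) ^ 2 := by
    have h1 := (hzV vV).2
    have h2 := (hzH vH).1
    have h3 : (k : ℝ) ^ 2 ≤ f k z ^ 2 := by gcongr
    calc (k * a) ^ 2 = (k : ℝ) ^ 2 * a ^ 2 := by ring
      _ ≤ f k z ^ 2 * (CV * gV.form z vV vV) := by gcongr
      _ = CV * (f k z ^ 2 * gV.form z vV vV) := by ring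
      _ ≤ CV * (CH * b ^ 2) := mul_le_mul_of_nonneg_left (hge.trans h2) hCV.le
      _ = CV * CH * b ^ 2 := by ring
      _ ≤ K ^ 2 * b ^ 2 := by
        refine mul_le_mul_of_nonneg_right ?_ (sq_nonneg b)
        rw [hK]
        nlinarith
      _ = (K * b) ^ 2 := by ring
  have hab' : k * a ≤ K * b := (sq_le_sq₀ (by positivity) (by positivity)).1 hab
  have h5 : (K + K / ε) * a ≤ K * (u + a) :=
    (mul_le_mul_of_nonneg_right hkK ha0).trans (hab'.trans (by gcongr))
  have h6 : K / ε * a ≤ K * u := by linarith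
  rw [div_mul_eq_mul_div, div_le_iff₀ hε] at h6
  nlinarith
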